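/- Let $D$ be a diagram of an unoriented framed link, with ordered crossings. A Kauffman state $s$ of $D$ assigns a marker $\pm1$ to every crossing; $D_s$ is the system of circles obtained by smoothing every crossing according to its marker (the positive marker joins the two regions swept by the upper strand when it is rotated counterclockwise, the negative marker joins the two other regions). An enhanced state $S$ is a state $s$ with a sign for every circle of $D_s$; $\sigma(S)$ is the number of positive minus the number of negative markers, and $\tau(S)$ the number of positive minus the number of negative circles. Let $C_{i,j}(D)$ be the free abelian group on the enhanced states with $\sigma(S)=i$ and $\sigma(S)+2\tau(S)=j$, and let $d_{i,j}:C_{i,j}(D)\to C_{i-2,j}(D)$ be $d(S)=\sum_{S'}(-1)^{t(S:S')}[S:S']\,S'$, where $[S:S']=1$ if the markers of $S$ and $S'$ differ at exactly one crossing $c$ and all circles not touching $c$ have the same sign in $S$ and $S'$, and $[S:S']=0$ otherwise, and where $t(S:S')$ is the number of negative markers of $S$ at crossings bigger than $c$. The Khovanov homology of $D$ is $H_{i,j}(D)=\ker d_{i,j}/d_{i+2,j}(C_{i+2,j}(D))$. Let $D_h$ be the standard two-crossing diagram of the Hopf link, let $n\ge 0$, and let $D=D_h\#\cdots\#D_h$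 be a connected sum of $n$ copies of $D_h$: a diagram obtained from the crossingless diagram of the trivial knot (for $n=0$) or from $D_h$ by successively forming the connected sum with further copies of $D_h$, each time at arbitrary arcs and with either way of joining the ends of the two cut arcs. Then, for every ordering of the crossings of $D$, $d\circ d=0$, all groups $H_{i,j}(D)$ are free abelian of finite rank, and $$\sum_{i,j\in\mathbb Z}\operatorname{rank}H_{i,j}(D)\;b^i a^j=(a^2+a^{-2})\,(a^4b^2+a^{-4}b^{-2})^n$$ in $\mathbb Z[a^{\pm1},b^{\pm1}]$. -/

import Mathlib

/-- A (combinatorial) diagram of an unoriented framed link.  Every crossing has four ends, numbered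
`0, 1, 2, 3` counterclockwise, the ends `0` and `2` belonging to the lower strand and the ends `1`
and `3` to the upper strand.  The arcs of the diagram which meet crossings are recorded by the
fixed-point-free involution `opp`, which sends each end of an arc to its other end; `loops` is the
number of simple closed curves of the diagram without crossings.  Planarity is not part of the
structure: it holds for the trivial knot and the Hopf link below and is preserved by connected
sums. -/
structure LinkDiagram where
  Crossing : Type
  [fintypeCrossing : Fintype Crossing]
  [decEqCrossing : DecidableEq Crossing]
  opp : Crossing × Fin 4 → Crossing × Fin 4
  opp_opp : ∀ p, opp (opp p) = p
  opp_ne : ∀ p, opp p ≠ p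
  loops : ℕ

namespace LinkDiagram

attribute [instance] LinkDiagram.fintypeCrossing LinkDiagram.decEqCrossing

/-! ### Kauffman states -/

/-- The ends of the crossings of `D`, i.e. the ends of its arcs. -/
abbrev Dart (D : LinkDiagram) : Type := D.Crossing × Fin 4

/-- The places on `D`: ends of arcs, and crossingless closed curves. -/
abbrev Place (D : LinkDiagram) : Type := D.Dart ⊕ Fin D.loops

/-- A Kauffman state: a marker `1` or `-1` at each crossing. -/
abbrev State (D : LinkDiagram) : Type := D.Crossing → ℤˣ

/-- The end of a crossing which is joined to a given end by smoothing along a marker.  The regions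
swept by the upper strand when it is rotated counterclockwise are those between the ends `1, 2` and
between the ends `3, 0`.  The positive marker joins these two regions, so that the ends `0, 1` and
the ends `2, 3` get connected; the negative marker connects `0, 3` and `1, 2`. -/
def smoothing (m : ℤˣ) : Fin 4 → Fin 4 :=
  if m = 1 then ![1, 0, 3, 2] else ![3, 2, 1, 0]

/-- Two places are adjacent in the smoothed diagram `D_s` if they are the two ends of an arc of `D`
or are joined by the smoothing of a crossing. -/
inductive Joined (D : LinkDiagram) (s : D.State) : D.Place → D.Place → Prop
  | arc (p : D.Dart) : Joined D s (.inl p) (.inl (D.opp p))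
  | smooth (c : D.Crossing) (k : Fin 4) :
      Joined D s (.inl (c, k)) (.inl (c, smoothing (s c) k))

/-- The circles of `D_s`. -/
def Circle (D : LinkDiagram) (s : D.State) : Type :=
  Quotient (Relation.EqvGen.setoid (D.Joined s))

/-- The circle of `D_s` through a given place. -/
def circleAt (D : LinkDiagram) (s : D.State) (x : D.Place) : D.Circle s :=
  Quotient.mk (Relation.EqvGen.setoid (D.Joined s)) x

instance (D : LinkDiagram) (s : D.State) : Finite (D.Circle s) :=
  inferInstanceAs (Finite (Quotient _))

noncomputable instance (D : LinkDiagram) (s : D.State) : Fintype (D.Circle s) :=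
  Fintype.ofFinite _

/-- An enhanced Kauffman state: a Kauffman state `s` and a sign for each circle of `D_s`. -/
structure EnhancedState (D : LinkDiagram) where
  marker : D.State
  sign : D.Circle marker → ℤˣ

instance (D : LinkDiagram) : Finite D.EnhancedState :=
  Finite.of_injective
    (fun S => (⟨S.marker, S.sign⟩ : Σ s : D.State, (D.Circle s → ℤˣ)))
    (by rintro ⟨s, f⟩ ⟨t, g⟩ h; cases h; rfl)

noncomputable instance (D : LinkDiagram) : Fintype D.EnhancedState :=
  Fintype.ofFinite _

variable {D : LinkDiagram}

/-- `σ(S)`: the number of positive markers minus the number of negative markers. -/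
def EnhancedState.sigma (S : D.EnhancedState) : ℤ := ∑ c, (S.marker c : ℤ)

/-- `τ(S)`: the number of positive circles minus the number of negative circles. -/
noncomputable def EnhancedState.tau (S : D.EnhancedState) : ℤ := ∑ γ, (S.sign γ : ℤ)

/-! ### The Khovanov chain complex and its homology -/

/-- `[S : S'] = 1`, where the markers of `S` and `S'` differ exactly at the crossing `c`: the marker
at `c` changes from positive to negative, the circles not touching `c` keep their signs, and
`τ(S') = τ(S) + 1` (so that `σ + 2τ` is preserved). -/
def Incident (c : D.Crossing) (S S' : D.EnhancedState) : Prop :=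
  S.marker c = 1 ∧ S'.marker = Function.update S.marker c (-1) ∧
  (∀ x : D.Place, (∀ k, D.circleAt S.marker x ≠ D.circleAt S.marker (.inl (c, k))) →
    S.sign (D.circleAt S.marker x) = S'.sign (D.circleAt S'.marker x)) ∧
  S'.tau = S.tau + 1

/-- An ordering of the crossings of `D`. -/
abbrev CrossingOrder (D : LinkDiagram) : Type := D.Crossing ≃ Fin (Fintype.card D.Crossing)

/-- The number of negative markers of `S` at crossings bigger than `c`. -/
def negAbove (e : D.CrossingOrder) (c : D.Crossing) (S : D.EnhancedState) : ℕ :=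
  (Finset.univ.filter fun x => e c < e x ∧ S.marker x = -1).card

open Classical in
/-- The coefficient `(-1) ^ t(S : S') * [S : S']` of `S'` in `d(S)`.  At most one crossing
contributes to the sum. -/
noncomputable def coefficient (e : D.CrossingOrder) (S S' : D.EnhancedState) : ℤ :=
  ∑ c, if Incident c S S' then (-1) ^ negAbove e c S else 0

/-- The enhanced states of bidegree `(σ, σ + 2τ) = (i, j)`. -/
def GradedState (D : LinkDiagram) (i j : ℤ) : Type :=
  {S : D.EnhancedState // S.sigma = i ∧ S.sigma + 2 * S.tau = j}

instance (D : LinkDiagram) (i j : ℤ) : Finite (D.GradedState i j) :=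
  inferInstanceAs (Finite {S : D.EnhancedState // S.sigma = i ∧ S.sigma + 2 * S.tau = j})

noncomputable instance (D : LinkDiagram) (i j : ℤ) : Fintype (D.GradedState i j) :=
  Fintype.ofFinite _

/-- The chain group `C_{i,j}(D)`: the free abelian group on the enhanced states of bidegree
`(i, j)`. -/
abbrev Chain (D : LinkDiagram) (i j : ℤ) : Type := D.GradedState i j →₀ ℤ

/-- The component `C_{i,j}(D) → C_{i',j}(D)` of the differential `d`.  It vanishes unless
`i' = i - 2`, and is only used in that case. -/
noncomputable def boundary (D : LinkDiagram) (e : D.CrossingOrder) (i i' j : ℤ) :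
    D.Chain i j →ₗ[ℤ] D.Chain i' j :=
  Finsupp.linearCombination ℤ fun S : D.GradedState i j =>
    ∑ S' : D.GradedState i' j, Finsupp.single S' (coefficient e S.1 S'.1)

/-- The Khovanov homology `H_{i,j}(D) = ker d_{i,j} / im d_{i+2,j}`.  (The image is intersected with
the kernel, which changes nothing as soon as `d ∘ d = 0`.) -/
abbrev Homology (D : LinkDiagram) (e : D.CrossingOrder) (i j : ℤ) : Type :=
  LinearMap.ker (D.boundary e i (i - 2) j) ⧸
    (LinearMap.range (D.boundary e (i + 2) i j)).comap
      (LinearMap.ker (D.boundary e i (i - 2) j)).subtype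

/-- Only finitely many of the groups `H_{i,j}(D)` have nonzero rank. -/
theorem finite_support_rank (D : LinkDiagram) (e : D.CrossingOrder) :
    (Function.support fun p : ℤ × ℤ =>
      (Module.finrank ℤ (D.Homology e p.1 p.2) : ℤ)).Finite := by
  refine (Set.finite_range
    fun S : D.EnhancedState => (S.sigma, S.sigma + 2 * S.tau)).subset fun p hp => ?_
  by_contra hS
  have : IsEmpty (D.GradedState p.1 p.2) := ⟨fun S => hS ⟨S.1, Prod.ext S.2.1 S.2.2⟩⟩
  exact hp (by simp [Module.finrank_zero_of_subsingleton])

/-- The ring `ℤ[a, a⁻¹, b, b⁻¹]`; its element `single (i, j) k` is `k bⁱ aʲ`. -/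
abbrev Laurent₂ : Type := AddMonoidAlgebra ℤ (ℤ × ℤ)

/-- The monomial `bⁱ aʲ`. -/
noncomputable def monomial (i j : ℤ) : Laurent₂ := AddMonoidAlgebra.single (i, j) 1

/-- The generating polynomial `h(a, b)(D)` of the free part of the Khovanov homology: the
coefficient of `bⁱ aʲ` is the rank of `H_{i,j}(D)`. -/
noncomputable def generatingPolynomial (D : LinkDiagram) (e : D.CrossingOrder) : Laurent₂ :=
  AddMonoidAlgebra.ofCoeff (Finsupp.ofSupportFinite
    (fun p : ℤ × ℤ => (Module.finrank ℤ (D.Homology e p.1 p.2) : ℤ)) (D.finite_support_rank e))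

/-! ### Connected sums and the Hopf link -/

/-- The involution `opp` on the ends of the arcs of the disjoint union of two diagrams. -/
def oppUnion (D D' : LinkDiagram) :
    (D.Crossing ⊕ D'.Crossing) × Fin 4 → (D.Crossing ⊕ D'.Crossing) × Fin 4
  | (.inl c, k) => Prod.map Sum.inl id (D.opp (c, k))
  | (.inr c, k) => Prod.map Sum.inr id (D'.opp (c, k))

theorem oppUnion_oppUnion (D D' : LinkDiagram) (p : (D.Crossing ⊕ D'.Crossing) × Fin 4) :
    oppUnion D D' (oppUnion D D' p) = p := by
  obtain ⟨c | c, k⟩ := p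
  · change Prod.map Sum.inl id (D.opp (D.opp (c, k))) = _
    rw [D.opp_opp]; rfl
  · change Prod.map Sum.inr id (D'.opp (D'.opp (c, k))) = _
    rw [D'.opp_opp]; rfl

theorem oppUnion_ne (D D' : LinkDiagram) (p : (D.Crossing ⊕ D'.Crossing) × Fin 4) :
    oppUnion D D' p ≠ p := by
  obtain ⟨c | c, k⟩ := p
  · intro h
    exact D.opp_ne (c, k) ((Sum.inl_injective.prodMap Function.injective_id) h)
  · intro h
    exact D'.opp_ne (c, k) ((Sum.inr_injective.prodMap Function.injective_id) h)

/-- The disjoint (split) union of `D` and `D'`, except that the number of crossingless closed curves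
is set to `l`. -/
def unionWithLoops (D D' : LinkDiagram) (l : ℕ) : LinkDiagram where
  Crossing := D.Crossing ⊕ D'.Crossing
  opp := oppUnion D D'
  opp_opp := oppUnion_oppUnion D D'
  opp_ne := oppUnion_ne D D'
  loops := l

/-- Interchange of the ends `p'` and `q` of the two arcs `{p, p'}` and `{q, q'}`: these arcs are
replaced by arcs `{p, q}` and `{p', q'}`, and all other arcs are kept. -/
def reconnect (D : LinkDiagram) (p q : D.Dart) : LinkDiagram where
  Crossing := D.Crossing
  opp x := Equiv.swap (D.opp p) q (D.opp (Equiv.swap (D.opp p) q x))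
  opp_opp x := by simp [D.opp_opp]
  opp_ne x h := D.opp_ne (Equiv.swap (D.opp p) q x) (by
    simpa using congrArg (Equiv.swap (D.opp p) q) h)
  loops := D.loops

/-- The connected sum of `D` and `D'` at given places.  If `p` and `q` are ends of arcs `{p, p'}` of
`D` and `{q, q'}` of `D'`, both arcs are cut and the loose ends are joined, `p` to `q` and `p'` to
`q'` (replacing `q` by `q'` gives the other way of joining them).  The connected sum along a
crossingless closed curve just removes this curve from the disjoint union. -/
def connectedSum (D D' : LinkDiagram) : D.Place → D'.Place → LinkDiagram
  | .inl (c, k), .inl (c', k') =>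
      (unionWithLoops D D' (D.loops + D'.loops)).reconnect (Sum.inl c, k) (Sum.inr c', k')
  | _, _ => unionWithLoops D D' (D.loops + D'.loops - 1)

/-- The diagram of the trivial knot without crossings. -/
def trivialKnot : LinkDiagram where
  Crossing := Empty
  opp := id
  opp_opp _ := rfl
  opp_ne p := p.1.elim
  loops := 1

/-- The standard diagram `D_h` of the Hopf link, with two crossings: the four arcs, starting from
the ends `0, 1, 2, 3` of one crossing, end at the ends `1, 0, 3, 2` of the other one. -/
def hopf : LinkDiagram where
  Crossing := Fin 2
  opp p := (Equiv.swap 0 1 p.1, ![1, 0, 3, 2] p.2)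
  opp_opp := by decide
  opp_ne := by decide
  loops := 0

/-- `D` is a connected sum `D_h # ⋯ # D_h` of `n` copies of the Hopf link diagram, formed at
arbitrary places and in arbitrary ways; the empty connected sum is the trivial knot, and `D_h`
itself is the case `n = 1`. -/
inductive IsHopfSum : ℕ → LinkDiagram → Prop
  | zero : IsHopfSum 0 trivialKnot
  | one : IsHopfSum 1 hopf
  | succ (n : ℕ) (D : LinkDiagram) (x : D.Place) (y : hopf.Place) (hD : IsHopfSum n D) :
      IsHopfSum (n + 1) (connectedSum D hopf x y)

end LinkDiagram

/-! Let `E` be a connected sum of `D` with the Hopf diagram, formed at a base point of `D`. A state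
of `E` is a state of `D` with two further markers. If these differ, all ends of the Hopf crossings
lie on the circle through the base point; if they agree, there is one additional circle. Hence the
chains of `E` are six copies of the chains of `D` (`HopfExtension.joinEquiv`).

Reading a negative circle as 1 and a positive one as X, signs live in ℤ[X]/(X²). Let X act on chains
of `D` at the base point (`mulX`). Absorbing the additional circle sends (z₀, z₁) to z₀ + Xz₁, and
splitting it off sends z to (Xz, z); with signs this is `comp_diff_formulas`. The identity
components 0 → 2 and 3 → 5 can be cancelled. What remains is the kernel of the merge, the chains
(-Xz, z), and the cokernel of the split: two copies of the complex of `D`, shifted by (2, 4) and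
(-2, -4). They form a direct sum of complexes, so homology is a direct sum as well
(`HopfExtension.nonempty_homologyAt_equiv`). Thus freeness is inherited and the polynomial is
multiplied by a⁴b² + a⁻⁴b⁻².

The argument needs d to commute with X at the base point. As the next sum may be formed anywhere,
the induction carries d² = 0 and commutation with X at every place (`HasHopfHomology`,
`HasHopfHomology.extend`). It starts from the trivial knot, where d = 0.

Reordering the crossings conjugates d by diagonal signs (`coefficient_eq_relCoefficient`), so the
Hopf crossings may be put last. The topology is confined to `HopfExtension`; its axioms follow from
finite checks on the Hopf diagram and from the fact that a circle cut at one arc is still connected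
(`eq_of_hopfClass_eq`). -/

/-! ### Homology of a graded endomorphism and deformation retractions -/

section Algebra

variable {M N : Type*} [AddCommGroup M] [AddCommGroup N]

/-- Cycles of `d` in `G` modulo the image of `G'`. -/
abbrev HomologyAt (d : M →ₗ[ℤ] M) (G G' : Submodule ℤ M) : Type _ :=
  ↥(LinearMap.ker d ⊓ G) ⧸ (G'.map d).comap (LinearMap.ker d ⊓ G).subtype

/-- A cycle of `d` in `G`, mapped by a chain map to a homology class. -/
def cycleMap {d : M →ₗ[ℤ] M} {d' : N →ₗ[ℤ] N} {G : Submodule ℤ M} {K : Submodule ℤ N}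
    (K' : Submodule ℤ N) (f : M →ₗ[ℤ] N) (hf : ∀ z, f (d z) = d' (f z))
    (hG : ∀ z ∈ G, f z ∈ K) :
    ↥(LinearMap.ker d ⊓ G) →ₗ[ℤ] HomologyAt d' K K' :=
  (Submodule.mkQ _) ∘ₗ (f.restrict (p := LinearMap.ker d ⊓ G) (q := LinearMap.ker d' ⊓ K)
    fun z hz => ⟨by rw [SetLike.mem_coe, LinearMap.mem_ker, ← hf, LinearMap.mem_ker.1 hz.1, map_zero], hG z hz.2⟩)

theorem cycleMap_eq_zero {d : M →ₗ[ℤ] M} {d' : N →ₗ[ℤ] N} {G : Submodule ℤ M}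
    {K : Submodule ℤ N} (K' : Submodule ℤ N) (f : M →ₗ[ℤ] N) (hf : ∀ z, f (d z) = d' (f z))
    (hG : ∀ z ∈ G, f z ∈ K) (z : ↥(LinearMap.ker d ⊓ G)) :
    cycleMap K' f hf hG z = 0 ↔ ∃ w ∈ K', d' w = f z := by
  simp [cycleMap, Submodule.Quotient.mk_eq_zero, Submodule.mem_map]
  rfl

/-- A deformation retraction of `(M, d)` onto two copies of `(N, d')` computes the homology. -/
theorem nonempty_homologyAt_equiv_prod (d : M →ₗ[ℤ] M) (d' : N →ₗ[ℤ] N)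
    {G G' : Submodule ℤ M} {K₁ K₁' K₂ K₂' : Submodule ℤ N}
    (f₁ f₂ : M →ₗ[ℤ] N) (g₁ g₂ : N →ₗ[ℤ] M) (h : M → M)
    (hf₁ : ∀ z, f₁ (d z) = d' (f₁ z)) (hf₂ : ∀ z, f₂ (d z) = d' (f₂ z))
    (hg₁ : ∀ z, g₁ (d' z) = d (g₁ z)) (hg₂ : ∀ z, g₂ (d' z) = d (g₂ z))
    (h₁₁ : ∀ z, f₁ (g₁ z) = z) (h₁₂ : ∀ z, f₁ (g₂ z) = 0)
    (h₂₁ : ∀ z, f₂ (g₁ z) = 0) (h₂₂ : ∀ z, f₂ (g₂ z) = z)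
    (hh : ∀ z, d z = 0 → z = g₁ (f₁ z) + g₂ (f₂ z) + d (h z))
    (hG : ∀ z ∈ G, f₁ z ∈ K₁ ∧ f₂ z ∈ K₂ ∧ h z ∈ G')
    (hG' : ∀ z ∈ G', f₁ z ∈ K₁' ∧ f₂ z ∈ K₂')
    (hK₁ : ∀ z ∈ K₁, g₁ z ∈ G) (hK₂ : ∀ z ∈ K₂, g₂ z ∈ G)
    (hK₁' : ∀ z ∈ K₁', g₁ z ∈ G') (hK₂' : ∀ z ∈ K₂', g₂ z ∈ G') :
    Nonempty (HomologyAt d G G' ≃ₗ[ℤ] HomologyAt d' K₁ K₁' × HomologyAt d' K₂ K₂') := by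
  let F := (cycleMap K₁' f₁ hf₁ (G := G) fun z hz => (hG z hz).1).prod
    (cycleMap K₂' f₂ hf₂ (G := G) fun z hz => (hG z hz).2.1)
  have hker : (G'.map d).comap (LinearMap.ker d ⊓ G).subtype = LinearMap.ker F := by
    ext ⟨z, hz⟩
    rw [LinearMap.mem_ker, Submodule.mem_comap, Submodule.mem_map]
    refine Iff.trans ?_ Prod.mk_eq_zero.symm
    rw [cycleMap_eq_zero, cycleMap_eq_zero]
    constructor
    · rintro ⟨w, hw, hwz⟩
      have hwz : d w = z := hwz
      exact ⟨⟨f₁ w, (hG' w hw).1, by rw [← hf₁, hwz]⟩, ⟨f₂ w, (hG' w hw).2, by rw [← hf₂, hwz]⟩⟩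
    · rintro ⟨⟨w₁, hw₁, e₁⟩, ⟨w₂, hw₂, e₂⟩⟩
      -- Lifting the two bounding chains by `g₁`, `g₂` and adding the homotopy term gives a chain
      -- bounding `z`.
      refine ⟨g₁ w₁ + g₂ w₂ + h z,
        add_mem (add_mem (hK₁' _ hw₁) (hK₂' _ hw₂)) (hG z hz.2).2.2, ?_⟩
      rw [map_add, map_add, ← hg₁, ← hg₂, e₁, e₂]
      exact (hh z hz.1).symm
  have hsurj : Function.Surjective F := by
    rintro ⟨x, y⟩
    obtain ⟨⟨x, hx⟩, rfl⟩ := Submodule.Quotient.mk_surjective _ x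
    obtain ⟨⟨y, hy⟩, rfl⟩ := Submodule.Quotient.mk_surjective _ y
    refine ⟨⟨g₁ x + g₂ y, ?_, add_mem (hK₁ x hx.2) (hK₂ y hy.2)⟩, ?_⟩
    · rw [SetLike.mem_coe, LinearMap.mem_ker, map_add, ← hg₁, ← hg₂, LinearMap.mem_ker.1 hx.1,
        LinearMap.mem_ker.1 hy.1, map_zero, map_zero, add_zero]
    · refine Prod.ext ?_ ?_
      · refine congrArg (Submodule.Quotient.mk) (Subtype.ext ?_)
        change f₁ (g₁ x + g₂ y) = x
        rw [map_add, h₁₁, h₁₂, add_zero]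
      · refine congrArg (Submodule.Quotient.mk) (Subtype.ext ?_)
        change f₂ (g₁ x + g₂ y) = y
        rw [map_add, h₂₁, h₂₂, zero_add]
  exact ⟨(Submodule.quotEquivOfEq _ _ hker).trans (F.quotKerEquivOfSurjective hsurj)⟩

/-- The homology of a graded piece, computed inside the total complex. -/
theorem nonempty_homology_equiv_homologyAt {A B C : Type*} [AddCommGroup A] [AddCommGroup B]
    [AddCommGroup C] (a : A →ₗ[ℤ] B) (b : B →ₗ[ℤ] C) (d : M →ₗ[ℤ] M)
    (iA : A →ₗ[ℤ] M) (iB : B →ₗ[ℤ] M) (iC : C →ₗ[ℤ] M)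
    (hB : Function.Injective iB) (hC : Function.Injective iC)
    (ha : ∀ x, d (iA x) = iB (a x)) (hb : ∀ x, d (iB x) = iC (b x)) :
    Nonempty ((LinearMap.ker b ⧸ (LinearMap.range a).comap (LinearMap.ker b).subtype) ≃ₗ[ℤ]
      HomologyAt d (LinearMap.range iB) (LinearMap.range iA)) := by
  let F : LinearMap.ker b →ₗ[ℤ] HomologyAt d (LinearMap.range iB) (LinearMap.range iA) :=
    (Submodule.mkQ _) ∘ₗ (iB.restrict (p := LinearMap.ker b)
      (q := LinearMap.ker d ⊓ LinearMap.range iB) fun z hz =>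
        ⟨by rw [SetLike.mem_coe, LinearMap.mem_ker, hb, LinearMap.mem_ker.1 hz, map_zero], ⟨z, rfl⟩⟩)
  have hker : (LinearMap.range a).comap (LinearMap.ker b).subtype = LinearMap.ker F := by
    ext ⟨z, hz⟩
    have : F ⟨z, hz⟩ = 0 ↔ ∃ w, d (iA w) = iB z := by
      simp [F, Submodule.Quotient.mk_eq_zero, Submodule.mem_map]
      rfl
    rw [LinearMap.mem_ker, this, Submodule.mem_comap, LinearMap.mem_range]
    exact exists_congr fun w => by rw [ha, hB.eq_iff]; rfl
  have hsurj : Function.Surjective F := by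
    intro x
    obtain ⟨⟨_, hx, y, rfl⟩, rfl⟩ := Submodule.Quotient.mk_surjective _ x
    -- Injectivity of `iC` makes `y` a cycle of `b`, not only of `d`.
    refine ⟨⟨y, hC ?_⟩, rfl⟩
    rw [← hb, map_zero]
    exact hx
  exact ⟨(Submodule.quotEquivOfEq _ _ hker).trans (F.quotKerEquivOfSurjective hsurj)⟩

end Algebra

namespace LinkDiagram

variable {D : LinkDiagram}

/-! ### Signs of enhanced states at places -/

theorem circleAt_eq_of_joined {s : D.State} {x y : D.Place} (h : D.Joined s x y) :
    D.circleAt s x = D.circleAt s y :=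
  Quotient.sound (s := Relation.EqvGen.setoid (D.Joined s)) (Relation.EqvGen.rel _ _ h)

namespace EnhancedState

/-- The sign of the circle through a place. -/
def val (S : D.EnhancedState) (x : D.Place) : ℤˣ := S.sign (D.circleAt S.marker x)

theorem ext_val {S T : D.EnhancedState} (hm : S.marker = T.marker)
    (hv : ∀ x, S.val x = T.val x) : S = T := by
  obtain ⟨s, f⟩ := S
  obtain ⟨t, g⟩ := T
  cases hm
  congr
  funext γ
  induction γ using Quotient.ind with
  | _ x => exact hv x

theorem val_congr (S : D.EnhancedState) {x y : D.Place}
    (h : D.circleAt S.marker x = D.circleAt S.marker y) : S.val x = S.val y := by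
  rw [val, val, h]

open Classical in
/-- Replace the sign of the circle through `x` by `a`. -/
noncomputable def setSign (S : D.EnhancedState) (x : D.Place) (a : ℤˣ) : D.EnhancedState :=
  ⟨S.marker, Function.update S.sign (D.circleAt S.marker x) a⟩

@[simp] theorem setSign_marker (S : D.EnhancedState) (x : D.Place) (a : ℤˣ) :
    (S.setSign x a).marker = S.marker := rfl

@[simp] theorem setSign_sigma (S : D.EnhancedState) (x : D.Place) (a : ℤˣ) :
    (S.setSign x a).sigma = S.sigma := rfl

theorem setSign_val_of_eq (S : D.EnhancedState) {x y : D.Place} (a : ℤˣ)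
    (h : D.circleAt S.marker y = D.circleAt S.marker x) : (S.setSign x a).val y = a := by
  classical
  simp only [val, setSign]
  rw [h, Function.update_self]

theorem setSign_val_of_ne (S : D.EnhancedState) {x y : D.Place} (a : ℤˣ)
    (h : D.circleAt S.marker y ≠ D.circleAt S.marker x) : (S.setSign x a).val y = S.val y := by
  classical
  simp only [val, setSign]
  exact Function.update_of_ne h _ _

theorem setSign_tau (S : D.EnhancedState) (x : D.Place) (a : ℤˣ) :
    (S.setSign x a).tau = S.tau + a - S.val x := by
  classical
  have h₁ : (S.setSign x a).tau = (a : ℤ) +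
      ∑ γ ∈ Finset.univ.erase (D.circleAt S.marker x), (S.sign γ : ℤ) := by
    unfold tau
    refine (Finset.add_sum_erase _ _ (Finset.mem_univ (D.circleAt S.marker x))).symm.trans ?_
    refine congrArg₂ _ ?_ (Finset.sum_congr rfl fun γ hγ => ?_)
    · simp [setSign]
    · simp [setSign, Function.update_of_ne (Finset.ne_of_mem_erase hγ)]
  have h₂ : S.tau = (S.val x : ℤ) +
      ∑ γ ∈ Finset.univ.erase (D.circleAt S.marker x), (S.sign γ : ℤ) := by
    unfold tau
    rw [← Finset.add_sum_erase _ _ (Finset.mem_univ (D.circleAt S.marker x))]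
    rfl
  rw [h₁, h₂]
  ring

theorem setSign_comm (S : D.EnhancedState) {x y : D.Place} (a b : ℤˣ)
    (h : D.circleAt S.marker y ≠ D.circleAt S.marker x) :
    (S.setSign x a).setSign y b = (S.setSign y b).setSign x a := by
  refine ext_val rfl fun z => ?_
  by_cases hz : D.circleAt S.marker z = D.circleAt S.marker x
  · rw [setSign_val_of_ne (S.setSign x a) _ (fun h' => h (h'.symm.trans hz)),
      setSign_val_of_eq _ _ hz, setSign_val_of_eq (S.setSign y b) _ hz]
  · rw [setSign_val_of_ne (S.setSign y b) _ hz]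
    by_cases hy : D.circleAt S.marker z = D.circleAt S.marker y
    · rw [setSign_val_of_eq (S.setSign x a) _ hy, setSign_val_of_eq _ _ hy]
    · rw [setSign_val_of_ne (S.setSign x a) _ hy, setSign_val_of_ne _ _ hy,
        setSign_val_of_ne _ _ hz]

/-! ### Enhanced states agreeing off one circle -/

/-- `S` and `T` have the same markers, and agree on all circles not passing through `x`. -/
def AgreeOff (x : D.Place) (S T : D.EnhancedState) : Prop :=
  S.marker = T.marker ∧
    ∀ y, D.circleAt S.marker y ≠ D.circleAt S.marker x → S.val y = T.val y

theorem AgreeOff.eq_setSign {x : D.Place} {S T : D.EnhancedState} (h : AgreeOff x S T) :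
    S = T.setSign x (S.val x) := by
  refine ext_val h.1 fun y => ?_
  by_cases hy : D.circleAt S.marker y = D.circleAt S.marker x
  · rw [setSign_val_of_eq _ _ (by rwa [← h.1]), S.val_congr hy]
  · rw [setSign_val_of_ne _ _ (by rwa [← h.1]), h.2 y hy]

theorem agreeOff_setSign (x : D.Place) (S : D.EnhancedState) (a : ℤˣ) :
    AgreeOff x (S.setSign x a) S :=
  ⟨rfl, fun _ hy => setSign_val_of_ne _ _ hy⟩

/-- Only the sign at `x` is free, and `tau` determines it. -/
theorem AgreeOff.eq_of_tau {x : D.Place} {S T : D.EnhancedState} :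
    AgreeOff x S T ∧ T.tau = S.tau ↔ S = T := by
  refine ⟨fun ⟨h, ht⟩ => ?_, fun h => h ▸ ⟨⟨rfl, fun _ _ => rfl⟩, rfl⟩⟩
  have h₁ := h.eq_setSign
  have h₂ := T.setSign_tau x (S.val x)
  rw [← h₁, ht] at h₂
  have h₃ : S.val x = T.val x := Units.ext (by linarith)
  rw [h₁, h₃]
  refine ext_val rfl fun y => ?_
  by_cases hy : D.circleAt T.marker y = D.circleAt T.marker x
  · rw [setSign_val_of_eq _ _ hy, T.val_congr hy]
  · rw [setSign_val_of_ne _ _ hy]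

/-- A single sign can raise `tau` by 2 only by passing from -1 to 1. -/
theorem AgreeOff.eq_of_tau_add_two {x : D.Place} {S T : D.EnhancedState} :
    AgreeOff x S T ∧ T.tau = S.tau + 2 ↔ T.val x = 1 ∧ S = T.setSign x (-1) := by
  constructor
  · rintro ⟨h, ht⟩
    have h₁ := h.eq_setSign
    have h₂ := T.setSign_tau x (S.val x)
    rw [← h₁, ht] at h₂
    rcases Int.units_eq_one_or (S.val x) with hS | hS <;>
      rcases Int.units_eq_one_or (T.val x) with hT | hT <;> rw [hS, hT] at h₂ <;>
      simp at h₂ <;> first | exact ⟨hT, by rw [← hS]; exact h₁⟩ | omega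
  · rintro ⟨hT, rfl⟩
    refine ⟨agreeOff_setSign x T _, ?_⟩
    rw [setSign_tau, hT]
    push_cast
    ring

end EnhancedState

open EnhancedState

/-! ### The action of a place -/

/-- Multiplication by `X` at the place `x`: it turns a negative circle through `x` into a positive
one, and kills the enhanced states whose circle through `x` is positive. -/
noncomputable def mulX (x : D.Place) : (D.EnhancedState → ℤ) →ₗ[ℤ] (D.EnhancedState → ℤ) where
  toFun z S := if S.val x = 1 then z (S.setSign x (-1)) else 0
  map_add' z w := by
    funext S
    by_cases h : S.val x = 1 <;> simp [h]
  map_smul' c z := by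
    funext S
    by_cases h : S.val x = 1 <;> simp [h]

theorem mulX_apply (x : D.Place) (z : D.EnhancedState → ℤ) (S : D.EnhancedState) :
    mulX x z S = if S.val x = 1 then z (S.setSign x (-1)) else 0 := rfl

theorem mulX_mulX_self (x : D.Place) (z : D.EnhancedState → ℤ) : mulX x (mulX x z) = 0 := by
  funext S
  have : ((-1 : ℤˣ) = 1) = False := by decide
  simp [mulX_apply, setSign_val_of_eq, this]

/-- On a common circle both sides vanish because X² = 0; on different circles the sign changes are
independent. -/
theorem mulX_comm (x y : D.Place) (z : D.EnhancedState → ℤ) :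
    mulX x (mulX y z) = mulX y (mulX x z) := by
  funext S
  have h1 : ((-1 : ℤˣ) = 1) = False := by decide
  by_cases h : D.circleAt S.marker y = D.circleAt S.marker x
  · simp [mulX_apply, setSign_val_of_eq _ _ h, setSign_val_of_eq _ _ h.symm, h1]
  · simp only [mulX_apply, setSign_val_of_ne _ _ h, setSign_val_of_ne _ _ (Ne.symm h),
      setSign_comm S _ _ h]
    split_ifs <;> rfl

open Classical in
theorem sum_agreeOff (x : D.Place) (z : D.EnhancedState → ℤ) (T : D.EnhancedState) :
    ∑ S, (if AgreeOff x S T ∧ T.tau = S.tau then z S else 0) = z T := by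
  simp [AgreeOff.eq_of_tau]

open Classical in
theorem sum_agreeOff_add_two (x : D.Place) (z : D.EnhancedState → ℤ) (T : D.EnhancedState) :
    ∑ S, (if AgreeOff x S T ∧ T.tau = S.tau + 2 then z S else 0) = mulX x z T := by
  simp only [AgreeOff.eq_of_tau_add_two, mulX_apply]
  by_cases h : T.val x = 1 <;> simp [h]

/-! ### The total differential -/

open Classical in
/-- The sign `(-1) ^ t`, where `t` is the number of negative markers at crossings `x` such that
`r c x`. -/
noncomputable def markerSign (r : D.Crossing → D.Crossing → Prop) (c : D.Crossing) (s : D.State) :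
    ℤˣ :=
  ∏ x, if r c x then s x else 1

open Classical in
/-- The coefficient of `S'` in `d(S)`, with signs determined by the relation `r`. -/
noncomputable def relCoefficient (r : D.Crossing → D.Crossing → Prop) (S S' : D.EnhancedState) :
    ℤ :=
  ∑ c, if Incident c S S' then (markerSign r c S.marker : ℤ) else 0

/-- The total differential, with signs determined by the relation `r`. -/
noncomputable def diff (r : D.Crossing → D.Crossing → Prop) :
    (D.EnhancedState → ℤ) →ₗ[ℤ] (D.EnhancedState → ℤ) where
  toFun z S' := ∑ S, z S * relCoefficient r S S'
  map_add' z w := by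
    funext S
    simp [add_mul, Finset.sum_add_distrib]
  map_smul' c z := by
    funext S
    simp [mul_assoc, Finset.mul_sum]

theorem diff_apply (r : D.Crossing → D.Crossing → Prop) (z : D.EnhancedState → ℤ)
    (S' : D.EnhancedState) : diff r z S' = ∑ S, z S * relCoefficient r S S' := rfl

theorem Incident.sigma_eq {c : D.Crossing} {S S' : D.EnhancedState} (h : Incident c S S') :
    S'.sigma = S.sigma - 2 := by
  unfold sigma
  rw [h.2.1, ← Finset.add_sum_erase _ _ (Finset.mem_univ c),
    ← Finset.add_sum_erase _ (fun x => (S.marker x : ℤ)) (Finset.mem_univ c), h.1,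
    Finset.sum_congr rfl fun x hx => by rw [Function.update_of_ne (Finset.ne_of_mem_erase hx)]]
  simp
  ring

theorem Incident.sigma_add_two_tau_eq {c : D.Crossing} {S S' : D.EnhancedState}
    (h : Incident c S S') : S'.sigma + 2 * S'.tau = S.sigma + 2 * S.tau := by
  rw [h.sigma_eq, h.2.2.2]
  ring

/-- The functions supported on enhanced states of bidegree `(i, j)`. -/
def gradedPart (D : LinkDiagram) (i j : ℤ) : Submodule ℤ (D.EnhancedState → ℤ) where
  carrier := {z | ∀ S, ¬ (S.sigma = i ∧ S.sigma + 2 * S.tau = j) → z S = 0}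
  add_mem' hz hw S hS := by simp [hz S hS, hw S hS]
  zero_mem' _ _ := rfl
  smul_mem' c z hz S hS := by simp [hz S hS]

theorem mulX_mem_gradedPart (x : D.Place) {i j : ℤ} {z : D.EnhancedState → ℤ}
    (hz : z ∈ D.gradedPart i j) : mulX x z ∈ D.gradedPart i (j + 4) := by
  intro S hS
  rw [mulX_apply]
  split_ifs with h
  · refine hz _ fun ⟨h₁, h₂⟩ => hS ⟨h₁, ?_⟩
    rw [setSign_tau, setSign_sigma, h] at h₂
    push_cast at h₂
    linarith
  · rfl

/-! ### Change of the ordering -/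

/-- Of any two different crossings exactly one precedes the other. -/
def IsTournament (r : D.Crossing → D.Crossing → Prop) : Prop :=
  (∀ c, ¬ r c c) ∧ ∀ c c', c ≠ c' → (r c c' ↔ ¬ r c' c)

open Classical in
/-- The sign relating the states for two tournaments `r` and `r'`: the parity of the number of pairs
of crossings with negative markers on which `r` and `r'` differ. -/
noncomputable def inversionSign (r r' : D.Crossing → D.Crossing → Prop) (s : D.State) : ℤˣ :=
  ∏ x, ∏ y, if r x y ∧ r' y x then (if s x = -1 then s y else 1) else 1

-- Since each unordered pair is counted at most once, making the marker at `c` negative contributes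
-- the marker of every crossing whose order relative to `c` differs between `r` and `r'`.
open Classical in
theorem inversionSign_update {r r' : D.Crossing → D.Crossing → Prop} (hr : IsTournament r)
    {c : D.Crossing} {s : D.State} (hc : s c = 1) :
    inversionSign r r' (Function.update s c (-1)) = inversionSign r r' s *
      ∏ y, if (r c y ∧ r' y c) ∨ (r y c ∧ r' c y) then s y else 1 := by
  have h1 : ((1 : ℤˣ) = -1) = False := by decide
  -- Only pairs containing `c` change: their factor was 1, because `s c = 1`, and becomes the marker
  -- of the other crossing.
  have key : ∀ x y, (if r x y ∧ r' y x then
        (if Function.update s c (-1) x = -1 then Function.update s c (-1) y else 1) else 1) =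
      (if r x y ∧ r' y x then (if s x = -1 then s y else 1) else 1) *
      ((if x = c then (if r c y ∧ r' y c then s y else 1) else 1) *
        (if y = c then (if r x c ∧ r' c x then s x else 1) else 1)) := by
    intro x y
    by_cases hx : x = c
    · subst hx
      by_cases hy : y = x
      · subst hy
        simp [hr.1]
      · simp [hc, h1, hy]
    · by_cases hy : y = c
      · subst hy
        rcases Int.units_eq_one_or (s x) with h | h <;> simp [hx, hc, h, h1]
      · simp [hx, hy]
  unfold inversionSign
  simp only [key, Finset.prod_mul_distrib]
  congr 1
  rw [Finset.prod_comm (f := fun x y => if x = c then _ else _)]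
  simp only [Finset.prod_ite_eq', Finset.mem_univ, if_true]
  rw [← Finset.prod_mul_distrib]
  refine Finset.prod_congr rfl fun y _ => ?_
  by_cases hy : y = c
  · subst hy
    simp [hr.1]
  · have := hr.2 y c hy
    by_cases h : r y c <;> simp_all

/-- The two marker signs at `c` differ by the markers of the crossings ordered differently relative
to `c`, which is exactly the change of `inversionSign` along the edge. -/
theorem markerSign_eq_mul {r r' : D.Crossing → D.Crossing → Prop} (hr : IsTournament r)
    (hr' : IsTournament r') {c : D.Crossing} {s : D.State} (hc : s c = 1) :
    markerSign r c s = inversionSign r r' s * inversionSign r r' (Function.update s c (-1)) *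
      markerSign r' c s := by
  classical
  rw [inversionSign_update hr hc, ← mul_assoc, Int.units_mul_self, one_mul]
  unfold markerSign
  rw [← Finset.prod_mul_distrib]
  refine Finset.prod_congr rfl fun y _ => ?_
  by_cases hy : y = c
  · subst hy
    simp [hr.1, hr'.1]
  · have h1 := hr.2 y c hy
    have h2 := hr'.2 y c hy
    by_cases h : r y c <;> by_cases h' : r' y c <;> simp_all

/-- The relation underlying an ordering of the crossings. -/
def orderRel (e : D.CrossingOrder) (c c' : D.Crossing) : Prop := e c < e c'

theorem isTournament_orderRel (e : D.CrossingOrder) : IsTournament (orderRel e) := by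
  refine ⟨fun c => lt_irrefl _, fun c c' h => ?_⟩
  have := e.injective.ne h
  unfold orderRel
  omega

theorem markerSign_orderRel (e : D.CrossingOrder) (c : D.Crossing) (S : D.EnhancedState) :
    (markerSign (orderRel e) c S.marker : ℤ) = (-1) ^ negAbove e c S := by
  classical
  have : markerSign (orderRel e) c S.marker = (-1) ^ negAbove e c S := by
    unfold markerSign negAbove
    rw [← Finset.prod_const, Finset.prod_filter]
    refine Finset.prod_congr rfl fun x _ => ?_
    unfold orderRel
    rcases Int.units_eq_one_or (S.marker x) with h | h <;> simp [h]
  rw [this]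
  simp

/-- The differentials for `e` and `r` are thus conjugate by a diagonal matrix of signs, so the
choice of order does not affect homology. -/
theorem coefficient_eq_relCoefficient (e : D.CrossingOrder)
    {r : D.Crossing → D.Crossing → Prop} (hr : IsTournament r) (S S' : D.EnhancedState) :
    coefficient e S S' = inversionSign (orderRel e) r S.marker *
      inversionSign (orderRel e) r S'.marker * relCoefficient r S S' := by
  classical
  unfold coefficient relCoefficient
  rw [Finset.mul_sum]
  refine Finset.sum_congr rfl fun c _ => ?_
  by_cases h : Incident c S S'
  · rw [if_pos h, if_pos h, ← markerSign_orderRel, h.2.1,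
      markerSign_eq_mul (isTournament_orderRel e) hr h.1]
    push_cast
    rfl
  · simp [h]

/-! ### The chain groups inside the total complex -/

open Classical in
/-- The inclusion of the chain group `C_{i,j}(D)` into the total complex, twisted by the signs which
compare the ordering `e` with the relation `r`. -/
noncomputable def chainInclusion (e : D.CrossingOrder) (r : D.Crossing → D.Crossing → Prop)
    (i j : ℤ) : D.Chain i j →ₗ[ℤ] (D.EnhancedState → ℤ) where
  toFun z S := if h : S.sigma = i ∧ S.sigma + 2 * S.tau = j then
    (inversionSign (orderRel e) r S.marker : ℤ) * z ⟨S, h⟩ else 0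
  map_add' z w := by
    funext S
    by_cases h : S.sigma = i ∧ S.sigma + 2 * S.tau = j
    · simp only [Pi.add_apply, dif_pos h]
      exact mul_add _ _ _
    · simp only [Pi.add_apply, dif_neg h, add_zero]
  map_smul' c z := by
    funext S
    by_cases h : S.sigma = i ∧ S.sigma + 2 * S.tau = j
    · simp only [Pi.smul_apply, dif_pos h, smul_eq_mul, RingHom.id_apply]
      exact mul_left_comm _ _ _
    · simp only [Pi.smul_apply, dif_neg h, smul_zero]

theorem chainInclusion_apply_of_mem (e : D.CrossingOrder) (r : D.Crossing → D.Crossing → Prop)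
    {i j : ℤ} (z : D.Chain i j) (S : D.GradedState i j) :
    chainInclusion e r i j z S.1 = (inversionSign (orderRel e) r S.1.marker : ℤ) * z S :=
  dif_pos S.2

theorem chainInclusion_apply_of_not_mem (e : D.CrossingOrder)
    (r : D.Crossing → D.Crossing → Prop) {i j : ℤ} (z : D.Chain i j) {S : D.EnhancedState}
    (h : ¬ (S.sigma = i ∧ S.sigma + 2 * S.tau = j)) : chainInclusion e r i j z S = 0 :=
  dif_neg h

theorem units_mul_self_mul (u : ℤˣ) (k : ℤ) : (u : ℤ) * (u * k) = k := by
  rw [← mul_assoc, ← Units.val_mul, Int.units_mul_self, Units.val_one, one_mul]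

theorem chainInclusion_injective (e : D.CrossingOrder) (r : D.Crossing → D.Crossing → Prop)
    (i j : ℤ) : Function.Injective (chainInclusion e r i j) := by
  intro z w h
  ext S
  have := congrFun h S.1
  rw [chainInclusion_apply_of_mem, chainInclusion_apply_of_mem] at this
  rw [← units_mul_self_mul (inversionSign (orderRel e) r S.1.marker) (z S), this,
    units_mul_self_mul]

theorem range_chainInclusion (e : D.CrossingOrder) (r : D.Crossing → D.Crossing → Prop)
    (i j : ℤ) : LinearMap.range (chainInclusion e r i j) = D.gradedPart i j := by
  ext z
  constructor
  · rintro ⟨w, rfl⟩ S hS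
    exact chainInclusion_apply_of_not_mem e r w hS
  · intro hz
    refine ⟨Finsupp.equivFunOnFinite.symm fun S =>
      (inversionSign (orderRel e) r S.1.marker : ℤ) * z S.1, ?_⟩
    funext S
    by_cases h : S.sigma = i ∧ S.sigma + 2 * S.tau = j
    · rw [chainInclusion_apply_of_mem e r _ ⟨S, h⟩]
      simp [units_mul_self_mul]
    · rw [chainInclusion_apply_of_not_mem e r _ h, hz S h]

theorem boundary_apply (e : D.CrossingOrder) (i i' j : ℤ) (z : D.Chain i j)
    (S' : D.GradedState i' j) :
    D.boundary e i i' j z S' = ∑ S : D.GradedState i j, z S * coefficient e S.1 S'.1 := by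
  classical
  unfold boundary
  rw [Finsupp.linearCombination_apply, Finsupp.sum_fintype _ _ (by simp), Finsupp.finsetSum_apply]
  refine Finset.sum_congr rfl fun S _ => ?_
  simp [Finsupp.single_apply]

theorem diff_chainInclusion (e : D.CrossingOrder) {r : D.Crossing → D.Crossing → Prop}
    (hr : IsTournament r) {i i' j : ℤ} (hi : i = i' + 2) (z : D.Chain i j) :
    diff r (chainInclusion e r i j z) = chainInclusion e r i' j (D.boundary e i i' j z) := by
  funext S'
  rw [diff_apply]
  by_cases hS' : S'.sigma = i' ∧ S'.sigma + 2 * S'.tau = j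
  · let T : D.GradedState i' j := ⟨S', hS'⟩
    have h := chainInclusion_apply_of_mem e r (D.boundary e i i' j z) T
    rw [boundary_apply, Finset.mul_sum] at h
    refine Eq.trans (Eq.symm ?_) h.symm
    refine Fintype.sum_of_injective (fun S : D.GradedState i j => S.1) Subtype.val_injective _ _ (fun S hS => ?_)
      fun S => ?_
    · rw [chainInclusion_apply_of_not_mem e r z, zero_mul]
      exact fun h => hS ⟨⟨S, h⟩, rfl⟩
    · rw [chainInclusion_apply_of_mem, coefficient_eq_relCoefficient e hr]
      -- The square of the sign of `S'` is inserted so that the conjugating signs match.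
      have := units_mul_self_mul (inversionSign (orderRel e) r S'.marker)
        (inversionSign (orderRel e) r S.1.marker * z S * relCoefficient r S.1 S')
      rw [← this]
      ring
  · rw [chainInclusion_apply_of_not_mem e r _ hS']
    refine Finset.sum_eq_zero fun S _ => ?_
    by_cases hS : S.sigma = i ∧ S.sigma + 2 * S.tau = j
    -- An incidence lowers σ by 2 and preserves σ + 2τ, so no term leaves the target bidegree.
    · refine mul_eq_zero_of_right _ (Finset.sum_eq_zero fun c _ => if_neg fun h => hS' ⟨?_, ?_⟩)
      · rw [h.sigma_eq, hS.1, hi, add_sub_cancel_right]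
      · rw [h.sigma_add_two_tau_eq, hS.2]
    · rw [chainInclusion_apply_of_not_mem e r z hS, zero_mul]

theorem boundary_comp_boundary (e : D.CrossingOrder) {r : D.Crossing → D.Crossing → Prop}
    (hr : IsTournament r) (hd : ∀ z, diff r (diff r z) = 0) (i j : ℤ) :
    D.boundary e i (i - 2) j ∘ₗ D.boundary e (i + 2) i j = 0 := by
  refine LinearMap.ext fun z => chainInclusion_injective e r (i - 2) j ?_
  rw [LinearMap.comp_apply, ← diff_chainInclusion e hr (by ring),
    ← diff_chainInclusion e hr (by ring), hd]
  simp

theorem nonempty_homology_equiv (e : D.CrossingOrder) {r : D.Crossing → D.Crossing → Prop}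
    (hr : IsTournament r) (i j : ℤ) :
    Nonempty (D.Homology e i j ≃ₗ[ℤ]
      HomologyAt (diff r) (D.gradedPart i j) (D.gradedPart (i + 2) j)) := by
  rw [← range_chainInclusion e r, ← range_chainInclusion e r]
  exact nonempty_homology_equiv_homologyAt _ _ _ _ _ (chainInclusion e r (i - 2) j)
    (chainInclusion_injective e r i j) (chainInclusion_injective e r (i - 2) j)
    (diff_chainInclusion e hr rfl) (diff_chainInclusion e hr (by ring))

variable {E : LinkDiagram}

/-! ### Extension of a diagram by a Hopf link -/

theorem eq_of_circleAt_eq {β : Type*} {s : D.State} (f : D.Place → β)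
    (hf : ∀ x y, D.Joined s x y → f x = f y) {x y : D.Place}
    (h : D.circleAt s x = D.circleAt s y) : f x = f y := by
  have h' : Relation.EqvGen (D.Joined s) x y := Quotient.exact h
  clear h
  induction h' with
  | rel x y h => exact hf x y h
  | refl x => rfl
  | symm x y _ ih => exact ih.symm
  | trans x y z _ _ ih₁ ih₂ => exact ih₁.trans ih₂

/-- A function on the circles of `D_s`, defined on places. -/
def circleLift {β : Type*} {s : D.State} (f : D.Place → β)
    (hf : ∀ x y, D.Joined s x y → f x = f y) : D.Circle s → β :=
  Quotient.lift f fun _ _ h =>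
    eq_of_circleAt_eq f hf (Quotient.sound (s := Relation.EqvGen.setoid (D.Joined s)) h)

theorem circle_surjective {s : D.State} (γ : D.Circle s) : ∃ x, D.circleAt s x = γ :=
  Quotient.exists_rep γ

/-- The state with given restrictions to the crossings of `D` and of the Hopf link. -/
def glueState (f : D.Crossing ⊕ Fin 2 ≃ E.Crossing) (s : D.State) (h : Fin 2 → ℤˣ) : E.State :=
  fun c => Sum.elim s h (f.symm c)

@[simp] theorem glueState_inl (f : D.Crossing ⊕ Fin 2 ≃ E.Crossing) (s : D.State)
    (h : Fin 2 → ℤˣ) (c : D.Crossing) : glueState f s h (f (.inl c)) = s c := by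
  simp [glueState]

@[simp] theorem glueState_inr (f : D.Crossing ⊕ Fin 2 ≃ E.Crossing) (s : D.State)
    (h : Fin 2 → ℤˣ) (i : Fin 2) : glueState f s h (f (.inr i)) = h i := by
  simp [glueState]

theorem glueState_injective {f : D.Crossing ⊕ Fin 2 ≃ E.Crossing} {s s' : D.State}
    {h h' : Fin 2 → ℤˣ} (e : glueState f s h = glueState f s' h') : s = s' ∧ h = h' :=
  ⟨funext fun c => by simpa using congrFun e (f (.inl c)),
    funext fun i => by simpa using congrFun e (f (.inr i))⟩

theorem glueState_update_inl (f : D.Crossing ⊕ Fin 2 ≃ E.Crossing) (s : D.State)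
    (h : Fin 2 → ℤˣ) (c : D.Crossing) (a : ℤˣ) :
    Function.update (glueState f s h) (f (.inl c)) a = glueState f (Function.update s c a) h := by
  funext x
  obtain ⟨x | i, rfl⟩ := f.surjective x
  · by_cases hx : x = c
    · subst hx
      simp
    · rw [Function.update_of_ne (by simpa using hx)]
      simp [hx]
  · rw [Function.update_of_ne (by simp)]
    simp

theorem glueState_update_inr (f : D.Crossing ⊕ Fin 2 ≃ E.Crossing) (s : D.State)
    (h : Fin 2 → ℤˣ) (i : Fin 2) (a : ℤˣ) :
    Function.update (glueState f s h) (f (.inr i)) a = glueState f s (Function.update h i a) := by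
  funext x
  obtain ⟨x | j, rfl⟩ := f.surjective x
  · rw [Function.update_of_ne (by simp)]
    simp
  · by_cases hj : j = i
    · subst hj
      simp
    · rw [Function.update_of_ne (by simpa using hj)]
      simp [hj]

theorem glueState_surjective (f : D.Crossing ⊕ Fin 2 ≃ E.Crossing) (t : E.State) :
    ∃ s h, glueState f s h = t :=
  ⟨fun c => t (f (.inl c)), fun i => t (f (.inr i)), by
    funext x
    obtain ⟨x | j, rfl⟩ := f.surjective x <;> simp⟩

/-! ### Abstract extensions by a Hopf link -/

/-- The data exhibiting `E` as the connected sum of `D` and the Hopf link diagram at the place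
`base`.  For every state of the Hopf link, `proj` sends each place of `E` to a place of `D` on
the corresponding circle, or to `none` on the circle which is disjoint from those of `D`. -/
structure HopfExtension (D E : LinkDiagram) where
  crossing : D.Crossing ⊕ Fin 2 ≃ E.Crossing
  base : D.Place
  proj : (Fin 2 → ℤˣ) → E.Place → Option D.Place
  lift : D.Place → E.Place
  proj_crossing : ∀ h c k, proj h (.inl (crossing (.inl c), k)) = some (.inl (c, k))
  proj_lift : ∀ h z, proj h (lift z) = some z
  proj_cases : ∀ u, (∃ z, ∀ h, proj h u = some z) ∨
    ∀ h, proj h u = some base ∨ (h 0 = h 1 ∧ proj h u = none)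
  proj_hopf : ∀ h i k, proj h (.inl (crossing (.inr i), k)) = some base ∨
    proj h (.inl (crossing (.inr i), k)) = none
  touch_base : ∀ h i, ∃ k, proj h (.inl (crossing (.inr i), k)) = some base
  touch_none : ∀ h i, h 0 = h 1 → ∃ k, proj h (.inl (crossing (.inr i), k)) = none
  map_eq_of_joined : ∀ s h u v, E.Joined (glueState crossing s h) u v →
    (proj h u).map (D.circleAt s) = (proj h v).map (D.circleAt s)
  circleAt_lift : ∀ s h z z', D.Joined s z z' →
    E.circleAt (glueState crossing s h) (lift z) = E.circleAt (glueState crossing s h) (lift z')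
  circleAt_of_some : ∀ s h u z, proj h u = some z →
    E.circleAt (glueState crossing s h) u = E.circleAt (glueState crossing s h) (lift z)
  circleAt_of_none : ∀ s h u v, proj h u = none → proj h v = none →
    E.circleAt (glueState crossing s h) u = E.circleAt (glueState crossing s h) v

namespace HopfExtension

variable (X : HopfExtension D E)

theorem exists_none {h : Fin 2 → ℤˣ} (hh : h 0 = h 1) : ∃ u, X.proj h u = none :=
  (X.touch_none h 0 hh).imp' (fun k => .inl (X.crossing (.inr 0), k)) fun _ hk => hk

theorem eq_of_proj_none {h : Fin 2 → ℤˣ} {u : E.Place} (hu : X.proj h u = none) : h 0 = h 1 := by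
  rcases X.proj_cases u with ⟨z, hz⟩ | H
  · simp [hz] at hu
  · rcases H h with hb | ⟨hh, -⟩
    · simp [hb] at hu
    · exact hh

theorem circleAt_lift_congr (s : D.State) (h : Fin 2 → ℤˣ) {z z' : D.Place}
    (e : D.circleAt s z = D.circleAt s z') :
    E.circleAt (glueState X.crossing s h) (X.lift z) =
      E.circleAt (glueState X.crossing s h) (X.lift z') :=
  eq_of_circleAt_eq (fun z => E.circleAt (glueState X.crossing s h) (X.lift z))
    (X.circleAt_lift s h) e

/-- `proj` is constant on circles, up to circles of `D`; conversely `lift` carries circles of `D`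
into circles of `E`, and the places sent to `none` form one circle. -/
theorem circleAt_eq_iff (s : D.State) (h : Fin 2 → ℤˣ) (u v : E.Place) :
    E.circleAt (glueState X.crossing s h) u = E.circleAt (glueState X.crossing s h) v ↔
      (X.proj h u).map (D.circleAt s) = (X.proj h v).map (D.circleAt s) := by
  refine ⟨fun e => eq_of_circleAt_eq (fun u => (X.proj h u).map (D.circleAt s))
    (X.map_eq_of_joined s h) e, fun e => ?_⟩
  rcases hu : X.proj h u with _ | z <;> rcases hv : X.proj h v with _ | z' <;>
    rw [hu, hv] at e <;> simp at e
  · exact X.circleAt_of_none s h u v hu hv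
  · rw [X.circleAt_of_some s h u z hu, X.circleAt_of_some s h v z' hv]
    exact X.circleAt_lift_congr s h e

/-- The circle of `D_s` corresponding to a circle of the extended diagram. -/
def circleProj (s : D.State) (h : Fin 2 → ℤˣ) :
    E.Circle (glueState X.crossing s h) → Option (D.Circle s) :=
  circleLift (fun u => (X.proj h u).map (D.circleAt s)) (X.map_eq_of_joined s h)

theorem circleProj_circleAt (s : D.State) (h : Fin 2 → ℤˣ) (u : E.Place) :
    X.circleProj s h (E.circleAt _ u) = (X.proj h u).map (D.circleAt s) := rfl

theorem circleProj_injective (s : D.State) (h : Fin 2 → ℤˣ) :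
    Function.Injective (X.circleProj s h) := by
  intro γ δ e
  obtain ⟨u, rfl⟩ := circle_surjective γ
  obtain ⟨v, rfl⟩ := circle_surjective δ
  exact (X.circleAt_eq_iff s h u v).2 e

/-- The enhanced state of the extended diagram composed of `S`, the markers `h` and the sign `a` of
the additional circle. -/
def join (h : Fin 2 → ℤˣ) (a : ℤˣ) (S : D.EnhancedState) : E.EnhancedState :=
  ⟨glueState X.crossing S.marker h, fun γ => (X.circleProj S.marker h γ).elim a S.sign⟩

@[simp] theorem join_marker (h : Fin 2 → ℤˣ) (a : ℤˣ) (S : D.EnhancedState) :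
    (X.join h a S).marker = glueState X.crossing S.marker h := rfl

theorem join_val (h : Fin 2 → ℤˣ) (a : ℤˣ) (S : D.EnhancedState) (u : E.Place) :
    (X.join h a S).val u = (X.proj h u).elim a S.val := by
  change ((X.proj h u).map (D.circleAt S.marker)).elim a S.sign = _
  cases X.proj h u <;> rfl

/-- For different Hopf markers there is no additional circle, and the sign parameter is a dummy. -/
theorem join_congr {h : Fin 2 → ℤˣ} {a b : ℤˣ} (hab : h 0 = h 1 → a = b)
    (S : D.EnhancedState) : X.join h a S = X.join h b S := by
  refine ext_val rfl fun u => ?_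
  rw [join_val, join_val]
  rcases hu : X.proj h u with _ | z
  · exact hab (X.eq_of_proj_none hu)
  · rfl

/-- The circles of `E` embed into `Option (D.Circle s)`; the image misses only `none`, and this just
when the Hopf markers differ. -/
theorem join_tau (h : Fin 2 → ℤˣ) (a : ℤˣ) (S : D.EnhancedState) :
    (X.join h a S).tau = S.tau + if h 0 = h 1 then (a : ℤ) else 0 := by
  have := Fintype.sum_of_injective (X.circleProj S.marker h) (X.circleProj_injective S.marker h)
    (fun γ => ((X.join h a S).sign γ : ℤ))
    (fun o => o.elim (if h 0 = h 1 then (a : ℤ) else 0) fun γ => (S.sign γ : ℤ)) ?_ ?_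
  · unfold tau
    refine this.trans ?_
    rw [Fintype.sum_option, add_comm]
    rfl
  · rintro (_ | γ) hγ
    · refine if_neg fun hh => hγ ?_
      obtain ⟨u, hu⟩ := X.exists_none hh
      exact ⟨E.circleAt _ u, by rw [circleProj_circleAt, hu]; rfl⟩
    · obtain ⟨z, rfl⟩ := circle_surjective γ
      exact (hγ ⟨E.circleAt _ (X.lift z), by rw [circleProj_circleAt, X.proj_lift]; rfl⟩).elim
  · intro γ
    obtain ⟨u, rfl⟩ := circle_surjective γ
    change (((X.circleProj S.marker h (E.circleAt _ u)).elim a S.sign : ℤˣ) : ℤ) = _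
    rw [circleProj_circleAt]
    rcases hu : X.proj h u with _ | z
    · exact (if_pos (X.eq_of_proj_none hu)).symm
    · rfl

theorem join_sigma (h : Fin 2 → ℤˣ) (a : ℤˣ) (S : D.EnhancedState) :
    (X.join h a S).sigma = S.sigma + (h 0 + h 1) := by
  unfold sigma
  rw [← X.crossing.sum_comp, Fintype.sum_sum_type]
  simp

theorem join_injective {h h' : Fin 2 → ℤˣ} {a a' : ℤˣ} {S S' : D.EnhancedState}
    (e : X.join h a S = X.join h' a' S') : h = h' ∧ (h 0 = h 1 → a = a') ∧ S = S' := by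
  obtain ⟨hs, rfl⟩ := glueState_injective (congrArg EnhancedState.marker e)
  refine ⟨rfl, fun hh => ?_, ext_val hs fun z => ?_⟩
  · obtain ⟨u, hu⟩ := X.exists_none hh
    simpa [join_val, hu] using congrArg (fun T => EnhancedState.val T u) e
  · simpa [join_val, X.proj_lift] using congrArg (fun T => EnhancedState.val T (X.lift z)) e

theorem join_surjective (T : E.EnhancedState) : ∃ h a S, X.join h a S = T := by
  obtain ⟨t, f⟩ := T
  obtain ⟨s, h, rfl⟩ := glueState_surjective X.crossing t
  let T : E.EnhancedState := ⟨_, f⟩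
  obtain ⟨a, ha⟩ : ∃ a, ∀ u, X.proj h u = none → T.val u = a := by
    by_cases hn : ∃ u, X.proj h u = none
    · obtain ⟨u, hu⟩ := hn
      exact ⟨T.val u, fun v hv => T.val_congr (X.circleAt_of_none s h v u hv hu)⟩
    -- Without an additional circle any sign will do.
    · exact ⟨1, fun u hu => (hn ⟨u, hu⟩).elim⟩
  refine ⟨h, a, ⟨s, circleLift (fun z => T.val (X.lift z)) fun z z' hz =>
    T.val_congr (X.circleAt_lift s h z z' hz)⟩, ext_val rfl fun u => ?_⟩
  rw [join_val]
  rcases hu : X.proj h u with _ | z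
  · exact (ha u hu).symm
  · exact (T.val_congr (X.circleAt_of_some s h u z hu)).symm

/-- The additional circle never touches a crossing of `D`, so it keeps its sign and cancels from the
condition on `tau`. -/
theorem incident_join_inl (c : D.Crossing) {h h' : Fin 2 → ℤˣ} {a a' : ℤˣ}
    {S S' : D.EnhancedState} :
    Incident (X.crossing (.inl c)) (X.join h a S) (X.join h' a' S') ↔
      h = h' ∧ (h 0 = h 1 → a = a') ∧ Incident c S S' := by
  have hmark : (X.join h' a' S').marker =
      Function.update (X.join h a S).marker (X.crossing (.inl c)) (-1) ↔
      h = h' ∧ S'.marker = Function.update S.marker c (-1) := by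
    rw [join_marker, join_marker, glueState_update_inl]
    exact ⟨fun e => ⟨(glueState_injective e).2.symm, (glueState_injective e).1⟩,
      fun e => by rw [e.1, e.2]⟩
  unfold Incident
  rw [hmark, show (X.join h a S).marker (X.crossing (.inl c)) = S.marker c from
    glueState_inl _ _ _ _]
  constructor
  · rintro ⟨hc, ⟨rfl, hm⟩, hv, ht⟩
    have hval : ∀ u, (∀ k, (X.proj h u).map (D.circleAt S.marker) ≠
        some (D.circleAt S.marker (.inl (c, k)))) →
        (X.proj h u).elim a S.val = (X.proj h u).elim a' S'.val := by
      intro u hu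
      rw [← join_val, ← join_val]
      refine hv u fun k e => hu k ?_
      rw [join_marker, circleAt_eq_iff, X.proj_crossing] at e
      exact e
    have haa : h 0 = h 1 → a = a' := by
      intro hh
      obtain ⟨u, hu⟩ := X.exists_none hh
      simpa [hu] using hval u (by simp [hu])
    refine ⟨rfl, haa, hc, hm, fun z hz => ?_, ?_⟩
    · have := hval (X.lift z) (by simpa [X.proj_lift] using hz)
      rw [X.proj_lift] at this
      exact this
    · rw [join_tau, join_tau] at ht
      by_cases hh : h 0 = h 1
      · rw [haa hh] at ht
        linarith
      · simpa [hh] using ht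
  · rintro ⟨rfl, haa, hc, hm, hv, ht⟩
    refine ⟨hc, ⟨rfl, hm⟩, fun u hu => ?_, ?_⟩
    · change (X.join h a S).val u = (X.join h a' S').val u
      rw [join_val, join_val]
      rcases hz : X.proj h u with _ | z
      · exact haa (X.eq_of_proj_none hz)
      · refine hv z fun k e => hu k ?_
        rw [join_marker, circleAt_eq_iff, X.proj_crossing, hz]
        exact congrArg some e
    · rw [join_tau, join_tau, ht]
      by_cases hh : h 0 = h 1
      · rw [haa hh]
        ring
      · simp [hh]

/-- A Hopf crossing touches exactly the base circle and, if present, the additional one. Hence the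
state on `D` may change only in the sign of the base circle. -/
theorem incident_join_inr (i : Fin 2) {h h' : Fin 2 → ℤˣ} {a a' : ℤˣ} {S S' : D.EnhancedState} :
    Incident (X.crossing (.inr i)) (X.join h a S) (X.join h' a' S') ↔
      (h i = 1 ∧ h' = Function.update h i (-1)) ∧ AgreeOff X.base S S' ∧
        (X.join h' a' S').tau = (X.join h a S).tau + 1 := by
  have hmark : (X.join h' a' S').marker =
      Function.update (X.join h a S).marker (X.crossing (.inr i)) (-1) ↔
      h' = Function.update h i (-1) ∧ S.marker = S'.marker := by
    rw [join_marker, join_marker, glueState_update_inr]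
    exact ⟨fun e => ⟨(glueState_injective e).2, (glueState_injective e).1.symm⟩,
      fun e => by rw [e.1, e.2]⟩
  have htouch : ∀ u, (∀ k, E.circleAt (X.join h a S).marker u ≠
      E.circleAt (X.join h a S).marker (.inl (X.crossing (.inr i), k))) ↔
      ∃ z, X.proj h u = some z ∧ D.circleAt S.marker z ≠ D.circleAt S.marker X.base := by
    intro u
    simp only [join_marker, Ne, circleAt_eq_iff]
    constructor
    · intro H
      rcases hu : X.proj h u with _ | z
      · obtain ⟨k, hk⟩ := X.touch_none h i (X.eq_of_proj_none hu)
        exact (H k (by rw [hu, hk])).elim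
      · obtain ⟨k, hk⟩ := X.touch_base h i
        refine ⟨z, rfl, fun e => H k ?_⟩
        rw [hu, hk]
        exact congrArg some e
    · rintro ⟨z, hz, hne⟩ k e
      rw [hz] at e
      rcases X.proj_hopf h i k with hk | hk
      · rw [hk] at e
        exact hne (Option.some.inj e)
      · simp [hk] at e
  -- A place whose projection depends on the Hopf markers projects to the base point or to `none`,
  -- so off the base circle the projection is unchanged.
  have hind : ∀ u z, X.proj h u = some z → D.circleAt S.marker z ≠ D.circleAt S.marker X.base →
      X.proj h' u = some z := by
    intro u z hz hne
    rcases X.proj_cases u with ⟨z', hz'⟩ | H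
    · rw [hz', ← hz, hz']
    · rcases H h with hb | ⟨-, hn⟩
      · rw [hb, Option.some.injEq] at hz
        exact (hne (by rw [hz])).elim
      · simp [hz] at hn
  unfold Incident AgreeOff
  rw [hmark]
  simp only [htouch]
  rw [show (X.join h a S).marker (X.crossing (.inr i)) = h i from glueState_inr _ _ _ _]
  constructor
  · rintro ⟨hi, ⟨hh, hm⟩, hv, ht⟩
    refine ⟨⟨hi, hh⟩, ⟨hm, fun z hz => ?_⟩, ht⟩
    have : (X.join h a S).val (X.lift z) = (X.join h' a' S').val (X.lift z) :=
      hv (X.lift z) ⟨z, X.proj_lift h z, hz⟩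
    simpa [join_val, X.proj_lift] using this
  · rintro ⟨⟨hi, hh⟩, ⟨hm, hv⟩, ht⟩
    refine ⟨hi, ⟨hh, hm⟩, ?_, ht⟩
    rintro u ⟨z, hz, hne⟩
    change (X.join h a S).val u = (X.join h' a' S').val u
    rw [join_val, join_val, hind u z hz hne, hz]
    exact hv z hne

end HopfExtension

/-! ### The differential in six components -/

/-- The markers of the six kinds of enhanced states of the Hopf link relative to a base point. -/
def hopfMarker : Fin 6 → Fin 2 → ℤˣ :=
  ![![1, 1], ![1, 1], ![1, -1], ![-1, 1], ![-1, -1], ![-1, -1]]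

/-- The signs of the additional circle in the six kinds of enhanced states of the Hopf link. -/
def hopfSign : Fin 6 → ℤˣ := ![-1, 1, 1, 1, -1, 1]

/-- The contributions of the additional circle to `τ`. -/
def hopfTau : Fin 6 → ℤ := ![-1, 1, 0, 0, -1, 1]

theorem hopfTau_eq : ∀ k : Fin 6,
    (if hopfMarker k 0 = hopfMarker k 1 then (hopfSign k : ℤ) else 0) = hopfTau k := by
  decide

/-- Signs are compared only for equal Hopf markers: for kinds 2 and 3 the value of `hopfSign` is a
dummy. -/
theorem hopfMarker_injective : ∀ k k' : Fin 6, hopfMarker k = hopfMarker k' →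
    (hopfMarker k 0 = hopfMarker k 1 → hopfSign k = hopfSign k') → k = k' := by
  decide

theorem hopfMarker_surjective (h : Fin 2 → ℤˣ) (a : ℤˣ) :
    ∃ k, hopfMarker k = h ∧ (h 0 = h 1 → hopfSign k = a) := by
  have H : ∀ x y : ℤˣ, ∃ k, hopfMarker k = ![x, y] ∧ (x = y → hopfSign k = a) := by
    revert a
    decide
  obtain ⟨k, h₁, h₂⟩ := H (h 0) (h 1)
  refine ⟨k, h₁.trans ?_, h₂⟩
  funext i
  fin_cases i <;> rfl

open Classical in
/-- The operator which changes the sign of the circle through `x` so that `τ` increases by `n`. -/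
noncomputable def raise (x : D.Place) (n : ℤ) (z : D.EnhancedState → ℤ) (T : D.EnhancedState) : ℤ :=
  ∑ S, if AgreeOff x S T ∧ T.tau = S.tau + n then z S else 0

@[simp] theorem raise_zero (x : D.Place) (z : D.EnhancedState → ℤ) (T : D.EnhancedState) :
    raise x 0 z T = z T := by
  classical
  refine Eq.trans (Finset.sum_congr rfl fun S _ => ?_) (sum_agreeOff x z T)
  exact if_congr (by rw [add_zero]) rfl rfl

@[simp] theorem raise_two (x : D.Place) (z : D.EnhancedState → ℤ) (T : D.EnhancedState) :
    raise x 2 z T = mulX x z T :=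
  sum_agreeOff_add_two x z T

namespace HopfExtension

variable (X : HopfExtension D E)

/-- Enhanced states of the extended diagram are enhanced states of `D` of six kinds. -/
noncomputable def joinEquiv : Fin 6 × D.EnhancedState ≃ E.EnhancedState :=
  Equiv.ofBijective (fun p => X.join (hopfMarker p.1) (hopfSign p.1) p.2) <| by
    constructor
    · rintro ⟨k, S⟩ ⟨k', S'⟩ e
      obtain ⟨h₁, h₂, h₃⟩ := X.join_injective e
      exact Prod.ext (hopfMarker_injective k k' h₁ h₂) h₃
    · intro T
      obtain ⟨h, a, S, rfl⟩ := X.join_surjective T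
      obtain ⟨k, rfl, hk⟩ := hopfMarker_surjective h a
      exact ⟨(k, S), X.join_congr hk S⟩

theorem joinEquiv_apply (k : Fin 6) (S : D.EnhancedState) :
    X.joinEquiv (k, S) = X.join (hopfMarker k) (hopfSign k) S := rfl

theorem joinEquiv_sigma (k : Fin 6) (S : D.EnhancedState) :
    (X.joinEquiv (k, S)).sigma = S.sigma + (hopfMarker k 0 + hopfMarker k 1) :=
  X.join_sigma _ _ S

theorem joinEquiv_tau (k : Fin 6) (S : D.EnhancedState) :
    (X.joinEquiv (k, S)).tau = S.tau + hopfTau k := by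
  rw [joinEquiv_apply, join_tau, hopfTau_eq]

/-- The relation on the crossings of the extended diagram in which those of the Hopf link come
after those of `D`. -/
def rel (r : D.Crossing → D.Crossing → Prop) (c c' : E.Crossing) : Prop :=
  Sum.Lex r (· < ·) (X.crossing.symm c) (X.crossing.symm c')

theorem isTournament_rel {r : D.Crossing → D.Crossing → Prop} (hr : IsTournament r) :
    IsTournament (X.rel r) := by
  constructor
  · intro c
    obtain ⟨c | i, rfl⟩ := X.crossing.surjective c <;> simp [rel, hr.1]
  · intro c c' hne
    obtain ⟨c | i, rfl⟩ := X.crossing.surjective c <;>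
      obtain ⟨c' | i', rfl⟩ := X.crossing.surjective c' <;> simp [rel]
    · exact hr.2 c c' (by simpa using hne)
    · have : i ≠ i' := by simpa using hne
      omega

/-- Both Hopf crossings come after `c`, so each contributes its marker. -/
theorem markerSign_inl (r : D.Crossing → D.Crossing → Prop) (c : D.Crossing) (s : D.State)
    (h : Fin 2 → ℤˣ) : markerSign (X.rel r) (X.crossing (.inl c)) (glueState X.crossing s h) =
      h 0 * h 1 * markerSign r c s := by
  classical
  unfold markerSign
  rw [← X.crossing.prod_comp, Fintype.prod_sum_type, mul_comm]
  simp [rel]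

theorem markerSign_inr (r : D.Crossing → D.Crossing → Prop) (i : Fin 2) (s : D.State)
    (h : Fin 2 → ℤˣ) : markerSign (X.rel r) (X.crossing (.inr i)) (glueState X.crossing s h) =
      if i = 0 then h 1 else 1 := by
  unfold markerSign
  rw [← X.crossing.prod_comp, Fintype.prod_sum_type]
  fin_cases i <;> simp [rel]

/-- The components of a chain of the extended diagram. -/
def comp (k : Fin 6) : (E.EnhancedState → ℤ) →ₗ[ℤ] (D.EnhancedState → ℤ) :=
  LinearMap.funLeft ℤ ℤ fun S => X.join (hopfMarker k) (hopfSign k) S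

theorem comp_apply (k : Fin 6) (z : E.EnhancedState → ℤ) (S : D.EnhancedState) :
    X.comp k z S = z (X.join (hopfMarker k) (hopfSign k) S) := rfl

theorem ext_comp {z w : E.EnhancedState → ℤ} (h : ∀ k, X.comp k z = X.comp k w) : z = w := by
  funext T
  obtain ⟨⟨k, S⟩, rfl⟩ := X.joinEquiv.surjective T
  exact congrFun (h k) S

theorem relCoefficient_join (r : D.Crossing → D.Crossing → Prop) (k k' : Fin 6)
    (S S' : D.EnhancedState) :
    relCoefficient (X.rel r) (X.join (hopfMarker k) (hopfSign k) S)
      (X.join (hopfMarker k') (hopfSign k') S') =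
      (if k = k' then (hopfMarker k 0 * hopfMarker k 1 : ℤ) * relCoefficient r S S' else 0) +
      ∑ i, if hopfMarker k i = 1 ∧ hopfMarker k' = Function.update (hopfMarker k) i (-1) then
        (if i = 0 then (hopfMarker k 1 : ℤ) else 1) *
          (open Classical in if AgreeOff X.base S S' ∧
            S'.tau = S.tau + (hopfTau k - hopfTau k' + 1) then 1 else 0)
        else 0 := by
  classical
  unfold relCoefficient
  rw [← X.crossing.sum_comp, Fintype.sum_sum_type]
  congr 1
  · rw [Finset.mul_sum]
    split_ifs with hk
    · subst hk
      refine Finset.sum_congr rfl fun c _ => ?_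
      rw [incident_join_inl]
      simp only [true_and, implies_true]
      split_ifs
      · rw [join_marker, markerSign_inl]
        push_cast
        rfl
      · simp
    · refine Finset.sum_eq_zero fun c _ => if_neg fun h => hk ?_
      rw [incident_join_inl] at h
      exact hopfMarker_injective k k' h.1 h.2.1
  · refine Finset.sum_congr rfl fun i _ => ?_
    -- The total `tau` grows by 1; subtracting the additional circle's share leaves the growth
    -- required on `D`.
    have htau : (X.join (hopfMarker k') (hopfSign k') S').tau =
        (X.join (hopfMarker k) (hopfSign k) S).tau + 1 ↔
        S'.tau = S.tau + (hopfTau k - hopfTau k' + 1) := by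
      rw [join_tau, join_tau, hopfTau_eq, hopfTau_eq]
      constructor <;> intro h <;> linarith
    rw [incident_join_inr, htau, join_marker, markerSign_inr]
    by_cases h : hopfMarker k i = 1 ∧ hopfMarker k' = Function.update (hopfMarker k) i (-1)
    · simp only [h, and_self, true_and, if_true, mul_ite, mul_one, mul_zero]
      congr 1
      split_ifs <;> rfl
    · simp only [h, false_and, if_false]

theorem comp_diff (r : D.Crossing → D.Crossing → Prop) (k' : Fin 6) (z : E.EnhancedState → ℤ)
    (S' : D.EnhancedState) :
    X.comp k' (diff (X.rel r) z) S' =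
      (hopfMarker k' 0 * hopfMarker k' 1 : ℤ) * diff r (X.comp k' z) S' +
      ∑ k, ∑ i, if hopfMarker k i = 1 ∧ hopfMarker k' = Function.update (hopfMarker k) i (-1) then
        (if i = 0 then (hopfMarker k 1 : ℤ) else 1) *
          raise X.base (hopfTau k - hopfTau k' + 1) (X.comp k z) S' else 0 := by
  classical
  rw [comp_apply, diff_apply, ← X.joinEquiv.sum_comp, Fintype.sum_prod_type]
  simp only [joinEquiv_apply, relCoefficient_join, mul_add, Finset.sum_add_distrib]
  congr 1
  · simp only [mul_ite, mul_zero]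
    rw [Finset.sum_comm]
    simp only [Finset.sum_ite_eq', Finset.mem_univ, if_true, diff_apply, Finset.mul_sum]
    exact Finset.sum_congr rfl fun S _ => by rw [comp_apply]; ring
  · refine Finset.sum_congr rfl fun k _ => ?_
    simp only [Finset.mul_sum]
    rw [Finset.sum_comm]
    refine Finset.sum_congr rfl fun i _ => ?_
    split_ifs <;> simp [raise, Finset.mul_sum, comp_apply, mul_comm]

/-- The differential of the extended diagram in terms of that of `D` and of the base point. -/
theorem comp_diff_formulas (r : D.Crossing → D.Crossing → Prop) (z : E.EnhancedState → ℤ) :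
    X.comp 0 (diff (X.rel r) z) = diff r (X.comp 0 z) ∧
    X.comp 1 (diff (X.rel r) z) = diff r (X.comp 1 z) ∧
    X.comp 2 (diff (X.rel r) z) =
      -diff r (X.comp 2 z) + (X.comp 0 z + mulX X.base (X.comp 1 z)) ∧
    X.comp 3 (diff (X.rel r) z) =
      -diff r (X.comp 3 z) + (X.comp 0 z + mulX X.base (X.comp 1 z)) ∧
    X.comp 4 (diff (X.rel r) z) =
      diff r (X.comp 4 z) + (mulX X.base (X.comp 3 z) - mulX X.base (X.comp 2 z)) ∧
    X.comp 5 (diff (X.rel r) z) = diff r (X.comp 5 z) + (X.comp 3 z - X.comp 2 z) := by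
  refine ⟨?_, ?_, ?_, ?_, ?_, ?_⟩ <;> funext S' <;> rw [comp_diff]
  -- The shift of τ is 0 for kinds 0 → 2, 3 and 2, 3 → 5, giving the identity, and 2 for 1 → 2, 3
  -- and 2, 3 → 4, giving `mulX`. The minus signs at 2 → 4, 5 come from changing the first Hopf
  -- marker while the second is negative.
  all_goals
    simp +decide [Fin.sum_univ_succ]
    simp [hopfMarker, hopfTau]
  all_goals ring

end HopfExtension

/-! ### The inductive invariant and its extension -/

/-- The rank of `H_{i,j}` of a connected sum of `n` Hopf links. -/
def hopfRank : ℕ → ℤ → ℤ → ℕ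
  | 0, i, j => if i = 0 ∧ (j = 2 ∨ j = -2) then 1 else 0
  | n + 1, i, j => hopfRank n (i - 2) (j - 4) + hopfRank n (i + 2) (j + 4)

/-- For the signs determined by `r`, the total differential of `D` squares to zero and commutes with
the actions of all places, and its homology is that of a connected sum of `n` Hopf links. -/
structure HasHopfHomology (n : ℕ) (D : LinkDiagram) (r : D.Crossing → D.Crossing → Prop) :
    Prop where
  isTournament : IsTournament r
  diff_diff : ∀ z, diff r (diff r z) = 0
  diff_mulX : ∀ x z, diff r (mulX x z) = mulX x (diff r z)
  free : ∀ i j, Module.Free ℤ (HomologyAt (diff r) (D.gradedPart i j) (D.gradedPart (i + 2) j))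
  finite : ∀ i j,
    Module.Finite ℤ (HomologyAt (diff r) (D.gradedPart i j) (D.gradedPart (i + 2) j))
  finrank : ∀ i j,
    Module.finrank ℤ (HomologyAt (diff r) (D.gradedPart i j) (D.gradedPart (i + 2) j)) =
      hopfRank n i j

namespace HopfExtension

variable (X : HopfExtension D E)

/-- The chain of the extended diagram with given components. -/
noncomputable def build : (Fin 6 → D.EnhancedState → ℤ) →ₗ[ℤ] (E.EnhancedState → ℤ) where
  toFun w T := w (X.joinEquiv.symm T).1 (X.joinEquiv.symm T).2
  map_add' _ _ := rfl
  map_smul' _ _ := rfl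

@[simp] theorem comp_build (w : Fin 6 → D.EnhancedState → ℤ) (k : Fin 6) :
    X.comp k (X.build w) = w k := by
  funext S
  change w (X.joinEquiv.symm (X.joinEquiv (k, S))).1 (X.joinEquiv.symm (X.joinEquiv (k, S))).2 = _
  rw [Equiv.symm_apply_apply]

theorem setSign_join_some {h : Fin 2 → ℤˣ} {u : E.Place} {x : D.Place}
    (hu : X.proj h u = some x) (a b : ℤˣ) (S : D.EnhancedState) :
    (X.join h a S).setSign u b = X.join h a (S.setSign x b) := by
  refine ext_val rfl fun v => ?_
  by_cases hv : E.circleAt (X.join h a S).marker v = E.circleAt (X.join h a S).marker u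
  · rw [setSign_val_of_eq _ _ hv, join_val]
    rw [join_marker, circleAt_eq_iff, hu] at hv
    rcases hv' : X.proj h v with _ | y
    · simp [hv'] at hv
    · rw [hv'] at hv
      exact (setSign_val_of_eq S b (Option.some.inj hv)).symm
  · rw [setSign_val_of_ne _ _ hv, join_val, join_val]
    rw [join_marker, circleAt_eq_iff, hu] at hv
    rcases hv' : X.proj h v with _ | y
    · rfl
    · rw [hv'] at hv
      exact (setSign_val_of_ne S b fun e => hv (congrArg some e)).symm

theorem setSign_join_none {h : Fin 2 → ℤˣ} {u : E.Place} (hu : X.proj h u = none) (a b : ℤˣ)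
    (S : D.EnhancedState) : (X.join h a S).setSign u b = X.join h b S := by
  refine ext_val rfl fun v => ?_
  by_cases hv : E.circleAt (X.join h a S).marker v = E.circleAt (X.join h a S).marker u
  · rw [setSign_val_of_eq _ _ hv, join_val]
    rw [join_marker, circleAt_eq_iff, hu] at hv
    rcases hv' : X.proj h v with _ | y
    · rfl
    · simp [hv'] at hv
  · rw [setSign_val_of_ne _ _ hv, join_val, join_val]
    rw [join_marker, circleAt_eq_iff, hu] at hv
    rcases hv' : X.proj h v with _ | y
    · simp [hv'] at hv
    · rfl

theorem comp_mulX_some {k : Fin 6} {u : E.Place} {x : D.Place}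
    (hu : X.proj (hopfMarker k) u = some x) (z : E.EnhancedState → ℤ) :
    X.comp k (mulX u z) = mulX x (X.comp k z) := by
  funext S
  rw [comp_apply, mulX_apply, mulX_apply, X.setSign_join_some hu, join_val, hu, comp_apply]
  rfl

theorem comp_mulX_none_of_neg {k : Fin 6} {u : E.Place} (hu : X.proj (hopfMarker k) u = none)
    (hk : hopfSign k = -1) (z : E.EnhancedState → ℤ) : X.comp k (mulX u z) = 0 := by
  funext S
  rw [comp_apply, mulX_apply, join_val, hu, hk]
  exact if_neg (show ¬ (-1 : ℤˣ) = 1 by decide)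

theorem comp_mulX_none_of_pos {k l : Fin 6} {u : E.Place} (hu : X.proj (hopfMarker k) u = none)
    (hkl : hopfMarker l = hopfMarker k) (hk : hopfSign k = 1) (hl : hopfSign l = -1)
    (z : E.EnhancedState → ℤ) : X.comp k (mulX u z) = X.comp l z := by
  funext S
  rw [comp_apply, mulX_apply, join_val, hu, hk, X.setSign_join_none hu, comp_apply, hkl, hl]
  rfl

theorem comp_mem_gradedPart {i j : ℤ} {z : E.EnhancedState → ℤ} (hz : z ∈ E.gradedPart i j)
    (k : Fin 6) {i' j' : ℤ} (hi : i' + (hopfMarker k 0 + hopfMarker k 1) = i)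
    (hj : j' + (hopfMarker k 0 + hopfMarker k 1) + 2 * hopfTau k = j) :
    X.comp k z ∈ D.gradedPart i' j' := by
  intro S hS
  refine hz (X.joinEquiv (k, S)) fun ⟨h₁, h₂⟩ => hS ?_
  rw [joinEquiv_sigma] at h₁ h₂
  rw [joinEquiv_tau] at h₂
  constructor <;> linarith

theorem mem_gradedPart_of_comp {i j : ℤ} {z : E.EnhancedState → ℤ}
    (hz : ∀ k, X.comp k z ∈ D.gradedPart (i - (hopfMarker k 0 + hopfMarker k 1))
      (j - (hopfMarker k 0 + hopfMarker k 1) - 2 * hopfTau k)) : z ∈ E.gradedPart i j := by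
  intro T hT
  obtain ⟨⟨k, S⟩, rfl⟩ := X.joinEquiv.surjective T
  refine hz k S fun ⟨h₁, h₂⟩ => hT ?_
  rw [joinEquiv_sigma, joinEquiv_tau]
  constructor <;> linarith

/-- The square of merges and splits anticommutes, and the sign of d on the mixed kinds cancels the
remaining cross terms because d commutes with X. -/
theorem diff_diff {r : D.Crossing → D.Crossing → Prop} (hd : ∀ z, diff r (diff r z) = 0)
    (hX : ∀ x z, diff r (mulX x z) = mulX x (diff r z)) (z : E.EnhancedState → ℤ) :
    diff (X.rel r) (diff (X.rel r) z) = 0 := by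
  obtain ⟨h0, h1, h2, h3, h4, h5⟩ := X.comp_diff_formulas r z
  obtain ⟨g0, g1, g2, g3, g4, g5⟩ := X.comp_diff_formulas r (diff (X.rel r) z)
  rw [h0, h1, h2, h3, h4, h5] at *
  refine X.ext_comp fun k => ?_
  rw [map_zero]
  fin_cases k
  · exact g0.trans (hd _)
  · exact g1.trans (hd _)
  · refine g2.trans ?_
    simp only [map_add, map_neg, hd, hX]
    abel
  · refine g3.trans ?_
    simp only [map_add, map_neg, hd, hX]
    abel
  · refine g4.trans ?_
    simp only [map_add, map_sub, map_neg, hd, hX]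
    abel
  · refine g5.trans ?_
    simp only [map_add, map_sub, hd]
    abel

/-- At a place coming from `D`, X acts on each component separately. At a place of the Hopf link it
acts as X at the base point or on the additional circle; the components then match by X² = 0. -/
theorem diff_mulX {r : D.Crossing → D.Crossing → Prop}
    (hX : ∀ x z, diff r (mulX x z) = mulX x (diff r z)) (u : E.Place) (z : E.EnhancedState → ℤ) :
    diff (X.rel r) (mulX u z) = mulX u (diff (X.rel r) z) := by
  obtain ⟨h0, h1, h2, h3, h4, h5⟩ := X.comp_diff_formulas r z
  obtain ⟨g0, g1, g2, g3, g4, g5⟩ := X.comp_diff_formulas r (mulX u z)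
  rcases X.proj_cases u with ⟨x, hx⟩ | H
  · have e : ∀ k z, X.comp k (mulX u z) = mulX x (X.comp k z) :=
      fun k z => X.comp_mulX_some (hx _) z
    have c := mulX_comm X.base x
    refine X.ext_comp fun k => ?_
    rw [e]
    fin_cases k
    · exact g0.trans (by simp [e, h0, hX])
    · exact g1.trans (by simp [e, h1, hX])
    · exact g2.trans (by simp [e, h2, hX, c])
    · exact g3.trans (by simp [e, h3, hX, c])
    · exact g4.trans (by simp [e, h4, hX, c])
    · exact g5.trans (by simp [e, h5, hX])
  · have mixed : ∀ k z, hopfMarker k 0 ≠ hopfMarker k 1 →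
        X.comp k (mulX u z) = mulX X.base (X.comp k z) := fun k z hk =>
      X.comp_mulX_some ((H _).resolve_right fun h => hk h.1) z
    have e2 := fun z => mixed 2 z (by decide)
    have e3 := fun z => mixed 3 z (by decide)
    -- With equal Hopf markers, `u` lies either on the base circle or on the additional one, where X
    -- moves the negative kind `k` to the positive kind `l`.
    have pure : ∀ k l, hopfMarker k = hopfMarker l → hopfSign k = -1 → hopfSign l = 1 →
        (∀ z, X.comp k (mulX u z) = mulX X.base (X.comp k z) ∧
          X.comp l (mulX u z) = mulX X.base (X.comp l z)) ∨
        (∀ z, X.comp k (mulX u z) = 0 ∧ X.comp l (mulX u z) = X.comp k z) := by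
      intro k l hkl hk hl
      rcases H (hopfMarker k) with h | ⟨-, h⟩
      · exact .inl fun z => ⟨X.comp_mulX_some h z, X.comp_mulX_some (hkl ▸ h) z⟩
      · exact .inr fun z => ⟨X.comp_mulX_none_of_neg h hk z,
          X.comp_mulX_none_of_pos (hkl ▸ h) hkl hl hk z⟩
    have hs := mulX_mulX_self X.base
    have P := pure 0 1 (by decide) (by decide) (by decide)
    have N := pure 4 5 (by decide) (by decide) (by decide)
    refine X.ext_comp fun k => ?_
    fin_cases k
    · refine g0.trans ?_
      rcases P with P | P <;> simp [(P _).1, h0, hX]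
    · refine g1.trans ?_
      rcases P with P | P <;> simp [(P _).2, h0, h1, hX]
    · refine g2.trans ?_
      rcases P with P | P <;> simp [(P _).1, (P _).2, e2, h2, hX, hs]
    · refine g3.trans ?_
      rcases P with P | P <;> simp [(P _).1, (P _).2, e3, h3, hX, hs]
    · refine g4.trans ?_
      rcases N with N | N <;> simp [(N _).1, e2, e3, h4, hX, hs]
    · refine g5.trans ?_
      rcases N with N | N <;> simp [(N _).2, e2, e3, h4, h5, hX]

/-- Adding a Hopf link doubles the homology, with shifts. -/
theorem nonempty_homologyAt_equiv {r : D.Crossing → D.Crossing → Prop}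
    (hX : ∀ x z, diff r (mulX x z) = mulX x (diff r z)) (i j : ℤ) :
    Nonempty (HomologyAt (diff (X.rel r)) (E.gradedPart i j) (E.gradedPart (i + 2) j) ≃ₗ[ℤ]
      HomologyAt (diff r) (D.gradedPart (i - 2) (j - 4)) (D.gradedPart (i - 2 + 2) (j - 4)) ×
      HomologyAt (diff r) (D.gradedPart (i + 2) (j + 4)) (D.gradedPart (i + 2 + 2) (j + 4))) := by
  have hs := mulX_mulX_self X.base
  -- `g₁` parametrizes the kernel of the merge (z₀, z₁) ↦ z₀ + Xz₁.
  let g₁ : (D.EnhancedState → ℤ) →ₗ[ℤ] (E.EnhancedState → ℤ) :=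
    X.build ∘ₗ LinearMap.pi ![-mulX X.base, LinearMap.id, 0, 0, 0, 0]
  -- `g₂` represents the cokernel of the split z ↦ (Xz, z); the matching projection is z₄ - Xz₅.
  let g₂ : (D.EnhancedState → ℤ) →ₗ[ℤ] (E.EnhancedState → ℤ) :=
    X.build ∘ₗ LinearMap.pi ![0, 0, 0, 0, LinearMap.id, 0]
  have hg₁ : ∀ k z, X.comp k (g₁ z) = (![-mulX X.base, LinearMap.id, 0, 0, 0, 0] :
      Fin 6 → (D.EnhancedState → ℤ) →ₗ[ℤ] (D.EnhancedState → ℤ)) k z :=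
    fun k z => by simp only [g₁, LinearMap.comp_apply, comp_build, LinearMap.pi_apply]
  have hg₂ : ∀ k z, X.comp k (g₂ z) = (![0, 0, 0, 0, LinearMap.id, 0] :
      Fin 6 → (D.EnhancedState → ℤ) →ₗ[ℤ] (D.EnhancedState → ℤ)) k z :=
    fun k z => by simp only [g₂, LinearMap.comp_apply, comp_build, LinearMap.pi_apply]
  -- `h` inverts the identity components 0 → 2 and 3 → 5 of the differential.
  let h : (E.EnhancedState → ℤ) → (E.EnhancedState → ℤ) := fun z =>
    X.build ![X.comp 2 z, 0, 0, X.comp 5 z, 0, 0]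
  have hh : ∀ k z, X.comp k (h z) = (![X.comp 2 z, 0, 0, X.comp 5 z, 0, 0] :
      Fin 6 → D.EnhancedState → ℤ) k := fun k z => comp_build ..
  have graded : ∀ i j z, z ∈ E.gradedPart i j → X.comp 1 z ∈ D.gradedPart (i - 2) (j - 4) ∧
      (X.comp 4 - mulX X.base ∘ₗ X.comp 5) z ∈ D.gradedPart (i + 2) (j + 4) := by
    intro i j z hz
    refine ⟨X.comp_mem_gradedPart hz 1 ?_ ?_, sub_mem (X.comp_mem_gradedPart hz 4 ?_ ?_)
      (mulX_mem_gradedPart _ (X.comp_mem_gradedPart hz 5 ?_ ?_))⟩ <;>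
      simp [hopfMarker, hopfTau] <;> ring
  have graded₁ : ∀ i j z, z ∈ D.gradedPart (i - 2) (j - 4) → g₁ z ∈ E.gradedPart i j := by
    intro i j z hz
    refine X.mem_gradedPart_of_comp fun k => ?_
    rw [hg₁]
    have h0 := mulX_mem_gradedPart X.base hz
    fin_cases k <;> simp [hopfMarker, hopfTau]
    · convert h0 using 2; ring
    · convert hz using 2; ring
  have graded₂ : ∀ i j z, z ∈ D.gradedPart (i + 2) (j + 4) → g₂ z ∈ E.gradedPart i j := by
    intro i j z hz
    refine X.mem_gradedPart_of_comp fun k => ?_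
    rw [hg₂]
    fin_cases k <;> simp [hopfMarker, hopfTau]
    · convert hz using 2; ring
  have gradedh : ∀ i j z, z ∈ E.gradedPart i j → h z ∈ E.gradedPart (i + 2) j := by
    intro i j z hz
    refine X.mem_gradedPart_of_comp fun k => ?_
    rw [hh]
    fin_cases k <;> simp [hopfMarker, hopfTau]
    · refine X.comp_mem_gradedPart hz 2 ?_ ?_ <;> simp [hopfMarker, hopfTau]
    · refine X.comp_mem_gradedPart hz 5 ?_ ?_ <;> simp [hopfMarker, hopfTau]
  refine nonempty_homologyAt_equiv_prod (diff (X.rel r)) (diff r) (X.comp 1)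
    (X.comp 4 - mulX X.base ∘ₗ X.comp 5) g₁ g₂ h ?_ ?_ ?_ ?_ ?_ ?_ ?_ ?_ ?_ ?_ ?_ ?_ ?_ ?_ ?_
  · exact fun z => (X.comp_diff_formulas r z).2.1
  · intro z
    obtain ⟨-, -, -, -, h4, h5⟩ := X.comp_diff_formulas r z
    simp only [LinearMap.sub_apply, LinearMap.comp_apply, h4, h5, map_add, map_sub, hX]
    abel
  · intro z
    obtain ⟨h0, h1, h2, h3, h4, h5⟩ := X.comp_diff_formulas r (g₁ z)
    refine X.ext_comp fun k => ?_
    rw [hg₁]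
    fin_cases k
    · exact (h0.trans (by simp [hg₁, hX])).symm
    · exact (h1.trans (by simp [hg₁])).symm
    · exact (h2.trans (by simp [hg₁])).symm
    · exact (h3.trans (by simp [hg₁])).symm
    · exact (h4.trans (by simp [hg₁])).symm
    · exact (h5.trans (by simp [hg₁])).symm
  · intro z
    obtain ⟨h0, h1, h2, h3, h4, h5⟩ := X.comp_diff_formulas r (g₂ z)
    refine X.ext_comp fun k => ?_
    rw [hg₂]
    fin_cases k
    · exact (h0.trans (by simp [hg₂])).symm
    · exact (h1.trans (by simp [hg₂])).symm
    · exact (h2.trans (by simp [hg₂])).symm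
    · exact (h3.trans (by simp [hg₂])).symm
    · exact (h4.trans (by simp [hg₂])).symm
    · exact (h5.trans (by simp [hg₂])).symm
  · exact fun z => by simp [hg₁]
  · exact fun z => by simp [hg₂]
  · exact fun z => by simp [hg₁]
  · exact fun z => by simp [hg₂]
  · intro z hz
    obtain ⟨h0, h1, h2, h3, h4, h5⟩ := X.comp_diff_formulas r z
    obtain ⟨k0, k1, k2, k3, k4, k5⟩ := X.comp_diff_formulas r (h z)
    simp only [hz, map_zero] at h0 h1 h2 h3 h4 h5
    -- The cycle equations in components 2 and 5 are what the homotopy identity needs in components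
    -- 0 and 3.
    have d2 : diff r (X.comp 2 z) = X.comp 0 z + mulX X.base (X.comp 1 z) :=
      neg_add_eq_zero.1 h2.symm
    have d5 : diff r (X.comp 5 z) = X.comp 2 z - X.comp 3 z := by
      rw [eq_neg_of_add_eq_zero_left h5.symm, neg_sub]
    refine X.ext_comp fun k => ?_
    rw [map_add, map_add, hg₁, hg₂]
    fin_cases k
    · simp [k0, hh, d2]
    · simp [k1, hh]
    · simp [k2, hh]
    · simp [k3, hh, d5]
    · simp [k4, hh]
    · simp [k5, hh]
  · exact fun z hz => ⟨(graded i j z hz).1, (graded i j z hz).2, gradedh i j z hz⟩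
  · intro z hz
    have := graded (i + 2) j z hz
    rwa [show i - 2 + 2 = i + 2 - 2 by ring]
  · exact graded₁ i j
  · exact graded₂ i j
  · intro z hz
    rw [show i - 2 + 2 = i + 2 - 2 by ring] at hz
    exact graded₁ (i + 2) j z hz
  · exact graded₂ (i + 2) j

end HopfExtension

theorem HasHopfHomology.extend {n : ℕ} {r : D.Crossing → D.Crossing → Prop}
    (hr : HasHopfHomology n D r) (X : HopfExtension D E) :
    HasHopfHomology (n + 1) E (X.rel r) where
  isTournament := X.isTournament_rel hr.isTournament
  diff_diff := X.diff_diff hr.diff_diff hr.diff_mulX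
  diff_mulX := X.diff_mulX hr.diff_mulX
  free i j := by
    obtain ⟨e⟩ := X.nonempty_homologyAt_equiv hr.diff_mulX i j
    have := hr.free (i - 2) (j - 4)
    have := hr.free (i + 2) (j + 4)
    exact Module.Free.of_equiv e.symm
  finite i j := by
    obtain ⟨e⟩ := X.nonempty_homologyAt_equiv hr.diff_mulX i j
    have := hr.finite (i - 2) (j - 4)
    have := hr.finite (i + 2) (j + 4)
    exact Module.Finite.equiv e.symm
  finrank i j := by
    obtain ⟨e⟩ := X.nonempty_homologyAt_equiv hr.diff_mulX i j
    have := hr.finite (i - 2) (j - 4)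
    have := hr.finite (i + 2) (j + 4)
    have := hr.free (i - 2) (j - 4)
    have := hr.free (i + 2) (j + 4)
    rw [e.finrank_eq, Module.finrank_prod, hr.finrank, hr.finrank]
    rfl

/-! ### Connected sums with the Hopf link as extensions -/

/-- The end of a crossing of the Hopf link joined to `u` by the smoothing with markers `m, n`. -/
def hopfSmooth (m n : ℤˣ) (u : Fin 2 × Fin 4) : Fin 2 × Fin 4 :=
  (u.1, smoothing (![m, n] u.1) u.2)

/-- The involution of the diagram of the Hopf link. -/
def hopfOpp (u : Fin 2 × Fin 4) : Fin 2 × Fin 4 := (Equiv.swap 0 1 u.1, ![1, 0, 3, 2] u.2)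

/-- One end of an arc and then the other end of the next arc along a circle of the smoothed Hopf
link. -/
def hopfNext (m n : ℤˣ) (u : Fin 2 × Fin 4) : Fin 2 × Fin 4 := hopfOpp (hopfSmooth m n u)

/-- The circle of the smoothed Hopf link on which an end lies. -/
def hopfClass (m n : ℤˣ) (u : Fin 2 × Fin 4) : Bool :=
  if m ≠ n then true else if m = 1 then u.2 < 2 else (u.2 = 0 ∨ u.2 = 3) ^^ (u.1 = 1)

theorem hopfClass_hopfOpp : ∀ m n u, hopfClass m n (hopfOpp u) = hopfClass m n u := by
  decide

theorem hopfClass_hopfSmooth : ∀ m n u, hopfClass m n (hopfSmooth m n u) = hopfClass m n u := by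
  decide

theorem hopfClass_of_ne {m n : ℤˣ} (h : m ≠ n) (u : Fin 2 × Fin 4) : hopfClass m n u = true :=
  if_pos h

/-- Every circle of the smoothed Hopf link passes through both crossings. -/
theorem exists_hopfClass_eq : ∀ m n (q : Fin 2 × Fin 4) (i : Fin 2),
    ∃ k, hopfClass m n (i, k) = hopfClass m n q := by
  decide

theorem exists_hopfClass_ne : ∀ m (q : Fin 2 × Fin 4) (i : Fin 2),
    ∃ k, hopfClass m m (i, k) ≠ hopfClass m m q := by
  decide

-- Starting at `q` with the smoothing, the walk leads away from the arc at `q` and meets the whole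
-- circle before traversing that arc. Four steps suffice, since a circle has at most eight ends.
set_option maxRecDepth 10000 in
theorem exists_hopfNext_iterate : ∀ m n (q u : Fin 2 × Fin 4), hopfClass m n u = hopfClass m n q →
    ∃ k : Fin 4, (u = (hopfNext m n)^[k] q ∨ u = hopfSmooth m n ((hopfNext m n)^[k] q)) ∧
      ∀ l : Fin 4, l < k → hopfSmooth m n ((hopfNext m n)^[l] q) ≠ q ∧
        hopfSmooth m n ((hopfNext m n)^[l] q) ≠ hopfOpp q := by
  decide

theorem hopfClass_iterate (m n : ℤˣ) (u : Fin 2 × Fin 4) (k : ℕ) :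
    hopfClass m n ((hopfNext m n)^[k] u) = hopfClass m n u := by
  induction k with
  | zero => rfl
  | succ k ih =>
    rw [Function.iterate_succ_apply', hopfNext, hopfClass_hopfOpp, hopfClass_hopfSmooth, ih]

/-- Cutting the arc at `q` does not disconnect the ends on a circle of the smoothed Hopf link. -/
theorem eq_of_hopfClass_eq {β : Type*} (m n : ℤˣ) (q : Fin 2 × Fin 4) (f : Fin 2 × Fin 4 → β)
    (hs : ∀ u, f (hopfSmooth m n u) = f u)
    (ho : ∀ u, u ≠ q → u ≠ hopfOpp q → f (hopfOpp u) = f u) {u v : Fin 2 × Fin 4}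
    (h : hopfClass m n u = hopfClass m n v) : f u = f v := by
  have walk : ∀ (w : Fin 2 × Fin 4) (k : ℕ), (∀ l < k, hopfSmooth m n ((hopfNext m n)^[l] w) ≠ q ∧
      hopfSmooth m n ((hopfNext m n)^[l] w) ≠ hopfOpp q) → f ((hopfNext m n)^[k] w) = f w := by
    intro w k
    induction k with
    | zero => exact fun _ => rfl
    | succ k ih =>
      intro H
      have := H k k.lt_succ_self
      rw [Function.iterate_succ_apply', hopfNext, ho _ this.1 this.2, hs]
      exact ih fun l hl => H l (hl.trans k.lt_succ_self)
  have key : ∀ u, hopfClass m n u = hopfClass m n q → f u = f q := by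
    intro u hu
    obtain ⟨k, hk, hl⟩ := exists_hopfNext_iterate m n q u hu
    have := walk q k fun l hlk => hl ⟨l, hlk.trans k.2⟩ hlk
    rcases hk with rfl | rfl
    · exact this
    · rw [hs, this]
  by_cases hq : hopfClass m n v = hopfClass m n q
  · rw [key u (h.trans hq), key v hq]
  -- This circle does not contain the cut arc, so the walk starting at `v` is unobstructed.
  · obtain ⟨k, hk, -⟩ := exists_hopfNext_iterate m n v u h
    have hne : ∀ w, hopfClass m n w = hopfClass m n v → w ≠ q ∧ w ≠ hopfOpp q := by
      refine fun w hw => ⟨?_, ?_⟩ <;> rintro rfl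
      · exact hq hw.symm
      · exact hq (hw.symm.trans (hopfClass_hopfOpp m n q))
    have := walk v k fun l _ => hne _ (by rw [hopfClass_hopfSmooth, hopfClass_iterate])
    rcases hk with rfl | rfl
    · exact this
    · rw [hs, this]

/-- The place of `D` corresponding to an end `u` of the Hopf link, if the connected sum is formed at
the end `q`. -/
def hopfProj (x : D.Place) (q : Fin 2 × Fin 4) (h : Fin 2 → ℤˣ) (u : Fin 2 × Fin 4) :
    Option D.Place :=
  if hopfClass (h 0) (h 1) u = hopfClass (h 0) (h 1) q then some x else none

section hopfProj

variable (x : D.Place) (q : Fin 2 × Fin 4) (h : Fin 2 → ℤˣ)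

theorem hopfProj_self : hopfProj x q h q = some x := if_pos rfl

theorem hopfProj_congr {u v : Fin 2 × Fin 4}
    (e : hopfClass (h 0) (h 1) u = hopfClass (h 0) (h 1) v) :
    hopfProj x q h u = hopfProj x q h v := by
  rw [hopfProj, hopfProj, e]

theorem hopfProj_hopfOpp (u : Fin 2 × Fin 4) :
    hopfProj x q h (hopfOpp u) = hopfProj x q h u :=
  hopfProj_congr x q h (hopfClass_hopfOpp _ _ u)

theorem hopfSmooth_eq (i : Fin 2) (k : Fin 4) :
    hopfSmooth (h 0) (h 1) (i, k) = (i, smoothing (h i) k) := by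
  fin_cases i <;> rfl

theorem hopfProj_smoothing (i : Fin 2) (k : Fin 4) :
    hopfProj x q h (i, smoothing (h i) k) = hopfProj x q h (i, k) := by
  rw [← hopfSmooth_eq]
  exact hopfProj_congr x q h (hopfClass_hopfSmooth _ _ _)

theorem hopfProj_cases (u : Fin 2 × Fin 4) :
    hopfProj x q h u = some x ∨ (h 0 = h 1 ∧ hopfProj x q h u = none) := by
  unfold hopfProj
  split_ifs with hu
  · exact .inl rfl
  · refine .inr ⟨by_contra fun hne => hu ?_, rfl⟩
    rw [hopfClass_of_ne hne, hopfClass_of_ne hne]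

theorem exists_hopfProj_eq_some (i : Fin 2) : ∃ k, hopfProj x q h (i, k) = some x :=
  (exists_hopfClass_eq (h 0) (h 1) q i).imp fun _ hk => if_pos hk

theorem exists_hopfProj_eq_none (i : Fin 2) (hh : h 0 = h 1) :
    ∃ k, hopfProj x q h (i, k) = none :=
  (exists_hopfClass_ne (h 0) q i).imp fun _ hk => if_neg (by rw [← hh]; exact hk)

/-- There are only two classes, so all ends off the class of `q` share a circle. -/
theorem hopfClass_eq_of_hopfProj_eq_none {u v : Fin 2 × Fin 4} (hu : hopfProj x q h u = none)
    (hv : hopfProj x q h v = none) : hopfClass (h 0) (h 1) u = hopfClass (h 0) (h 1) v := by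
  unfold hopfProj at hu hv
  split_ifs at hu with hu'
  split_ifs at hv with hv'
  rw [Bool.eq_not_of_ne hu', Bool.eq_not_of_ne hv']

theorem hopfClass_eq_of_hopfProj_eq_some {u : Fin 2 × Fin 4} {z : D.Place}
    (hu : hopfProj x q h u = some z) :
    hopfClass (h 0) (h 1) u = hopfClass (h 0) (h 1) q ∧ z = x := by
  unfold hopfProj at hu
  split_ifs at hu with hu'
  exact ⟨hu', (Option.some.inj hu).symm⟩

end hopfProj

/-! ### Extensions of the crossingless trivial knot -/

/-- The projection of the places of `E` to those of `D`, if `E` has the crossings of a Hopf link and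
no others. -/
def crossinglessProj [IsEmpty D.Crossing] (x : D.Place) (f : D.Crossing ⊕ Fin 2 ≃ E.Crossing)
    (h : Fin 2 → ℤˣ) : E.Place → Option D.Place
  | .inl (c, k) => hopfProj x (0, 0) h (Sum.elim isEmptyElim id (f.symm c), k)
  | .inr _ => some x

theorem crossinglessProj_inr [IsEmpty D.Crossing] (x : D.Place)
    (f : D.Crossing ⊕ Fin 2 ≃ E.Crossing) (h : Fin 2 → ℤˣ) (i : Fin 2) (k : Fin 4) :
    crossinglessProj x f h (.inl (f (.inr i), k)) = hopfProj x (0, 0) h (i, k) := by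
  simp [crossinglessProj]

/-- A diagram with the crossings and arcs of the Hopf link diagram extends a diagram of the trivial
knot without crossings. -/
def crossinglessExtension [IsEmpty D.Crossing] (x : D.Place) (hx : ∀ z, z = x)
    (f : D.Crossing ⊕ Fin 2 ≃ E.Crossing) (hl : E.loops = 0)
    (ho : ∀ u, E.opp (f (.inr u.1), u.2) = (f (.inr (hopfOpp u).1), (hopfOpp u).2)) :
    HopfExtension D E :=
  have hplace : ∀ v : E.Place, ∃ i k, v = .inl (f (.inr i), k) := by
    rintro (⟨c, k⟩ | l)
    · obtain ⟨c | i, rfl⟩ := f.surjective c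
      · exact isEmptyElim c
      · exact ⟨i, k, rfl⟩
    · exact (Fin.cast hl l).elim0
  have hcircle : ∀ s h (u v : Fin 2 × Fin 4),
      hopfClass (h 0) (h 1) u = hopfClass (h 0) (h 1) v →
      E.circleAt (glueState f s h) (.inl (f (.inr u.1), u.2)) =
        E.circleAt (glueState f s h) (.inl (f (.inr v.1), v.2)) := by
    intro s h u v huv
    -- No arc is cut here; the end `(0, 0)` merely selects the circle identified with the trivial
    -- knot.
    refine eq_of_hopfClass_eq (h 0) (h 1) (0, 0)
      (fun u => E.circleAt (glueState f s h) (.inl (f (.inr u.1), u.2))) ?_ ?_ huv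
    · rintro ⟨i, k⟩
      have := circleAt_eq_of_joined (Joined.smooth (s := glueState f s h) (f (.inr i)) k)
      rw [glueState_inr] at this
      rw [hopfSmooth_eq]
      exact this.symm
    · intro u _ _
      have := circleAt_eq_of_joined (Joined.arc (s := glueState f s h) (f (.inr u.1), u.2))
      rw [ho] at this
      exact this.symm
  { crossing := f
    base := x
    proj := crossinglessProj x f
    lift := fun _ => .inl (f (.inr 0), 0)
    proj_crossing := fun _ c => isEmptyElim c
    proj_lift := fun h z => by rw [crossinglessProj_inr, hopfProj_self, hx z]
    proj_cases := fun v => by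
      obtain ⟨i, k, rfl⟩ := hplace v
      simp only [crossinglessProj_inr]
      exact .inr fun h => hopfProj_cases _ _ h _
    proj_hopf := fun h i k => by
      simp only [crossinglessProj_inr]
      exact (hopfProj_cases _ _ h _).imp_right And.right
    touch_base := fun h i => by
      simp only [crossinglessProj_inr]
      exact exists_hopfProj_eq_some _ _ h i
    touch_none := fun h i hh => by
      simp only [crossinglessProj_inr]
      exact exists_hopfProj_eq_none _ _ h i hh
    map_eq_of_joined := fun s h u v huv => by
      refine congrArg _ ?_
      cases huv with
      | arc p =>
        obtain ⟨c, k⟩ := p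
        obtain ⟨c | i, rfl⟩ := f.surjective c
        · exact isEmptyElim c
        · rw [ho (i, k), crossinglessProj_inr, crossinglessProj_inr]
          exact (hopfProj_hopfOpp _ _ h (i, k)).symm
      | smooth c k =>
        obtain ⟨c | i, rfl⟩ := f.surjective c
        · exact isEmptyElim c
        · rw [glueState_inr, crossinglessProj_inr, crossinglessProj_inr, hopfProj_smoothing]
    circleAt_lift := fun _ _ _ _ _ => rfl
    circleAt_of_some := fun s h u z hu => by
      obtain ⟨i, k, rfl⟩ := hplace u
      rw [crossinglessProj_inr] at hu
      exact hcircle s h (i, k) (0, 0) (hopfClass_eq_of_hopfProj_eq_some _ _ h hu).1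
    circleAt_of_none := fun s h u v hu hv => by
      obtain ⟨i, k, rfl⟩ := hplace u
      obtain ⟨i', k', rfl⟩ := hplace v
      rw [crossinglessProj_inr] at hu hv
      exact hcircle s h (i, k) (i', k') (hopfClass_eq_of_hopfProj_eq_none _ _ h hu hv) }

instance : IsEmpty trivialKnot.Crossing := inferInstanceAs (IsEmpty Empty)

theorem trivialKnot_place_eq (x : trivialKnot.Place) : x = .inr (0 : Fin 1) := by
  obtain ⟨c, -⟩ | l := x
  · exact isEmptyElim c
  · exact congrArg Sum.inr (Subsingleton.elim (α := Fin 1) _ _)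

/-- The Hopf link diagram as an extension of the trivial knot. -/
def hopfExtensionHopf : HopfExtension trivialKnot hopf :=
  crossinglessExtension (.inr (0 : Fin 1)) trivialKnot_place_eq (Equiv.emptySum _ _) rfl fun _ => rfl

/-- The connected sum of the trivial knot and the Hopf link diagram as an extension of the trivial
knot. -/
def hopfExtensionTrivialKnot (l : Fin trivialKnot.loops) (q : hopf.Dart) :
    HopfExtension trivialKnot (connectedSum trivialKnot hopf (.inr l) (.inl q)) :=
  crossinglessExtension (.inr (0 : Fin 1)) trivialKnot_place_eq (Equiv.refl _) rfl fun _ => rfl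

/-! ### Connected sums at two arcs -/

/-- The projection of the places of a connected sum at arcs to the places of `D`. -/
def connectedSumProj (D : LinkDiagram) (p : D.Dart) (q : Fin 2 × Fin 4) (h : Fin 2 → ℤˣ) :
    (connectedSum D hopf (.inl p) (.inl q)).Place → Option D.Place
  | .inl (.inl c, k) => some (.inl (c, k))
  | .inl (.inr i, k) => hopfProj (.inl p) q h (i, k)
  | .inr l => some (.inr (Fin.cast (Nat.add_zero D.loops) l))

section connectedSum

variable (D : LinkDiagram) (p : D.Dart) (q : Fin 2 × Fin 4)

/-- The end of an arc of a connected sum given by an end of an arc of `D`. -/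
def sumInl (u : D.Dart) : (connectedSum D hopf (.inl p) (.inl q)).Dart := (Sum.inl u.1, u.2)

/-- The end of an arc of a connected sum given by an end of an arc of the Hopf link diagram. -/
def sumInr (u : Fin 2 × Fin 4) : (connectedSum D hopf (.inl p) (.inl q)).Dart :=
  (Sum.inr u.1, u.2)

theorem connectedSum_opp (x : (connectedSum D hopf (.inl p) (.inl q)).Dart) :
    (connectedSum D hopf (.inl p) (.inl q)).opp x =
      Equiv.swap (sumInl D p q (D.opp p)) (sumInr D p q q)
        (oppUnion D hopf (Equiv.swap (sumInl D p q (D.opp p)) (sumInr D p q q) x)) := rfl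

theorem oppUnion_sumInl (u : D.Dart) :
    oppUnion D hopf (sumInl D p q u) = sumInl D p q (D.opp u) := rfl

theorem oppUnion_sumInr (u : Fin 2 × Fin 4) :
    oppUnion D hopf (sumInr D p q u) = sumInr D p q (hopfOpp u) := rfl

theorem sumInl_injective : Function.Injective (sumInl D p q) := by
  rintro ⟨c, k⟩ ⟨c', k'⟩ h
  cases h
  rfl

theorem sumInr_injective : Function.Injective (sumInr D p q) := by
  rintro ⟨c, k⟩ ⟨c', k'⟩ h
  cases h
  rfl

theorem sumInl_ne_sumInr (u : D.Dart) (v : Fin 2 × Fin 4) : sumInl D p q u ≠ sumInr D p q v :=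
  fun h => Sum.inl_ne_inr (congrArg Prod.fst h)

theorem hopfOpp_hopfOpp : ∀ u, hopfOpp (hopfOpp u) = u := by decide

theorem hopfOpp_ne : ∀ u, hopfOpp u ≠ u := by decide

theorem opp_sumInl_self :
    (connectedSum D hopf (.inl p) (.inl q)).opp (sumInl D p q p) = sumInr D p q q := by
  rw [connectedSum_opp, Equiv.swap_apply_of_ne_of_ne
    ((sumInl_injective D p q).ne (D.opp_ne p).symm) (sumInl_ne_sumInr D p q _ _),
    oppUnion_sumInl, Equiv.swap_apply_left]

theorem opp_sumInl_opp :
    (connectedSum D hopf (.inl p) (.inl q)).opp (sumInl D p q (D.opp p)) =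
      sumInr D p q (hopfOpp q) := by
  rw [connectedSum_opp, Equiv.swap_apply_left, oppUnion_sumInr, Equiv.swap_apply_of_ne_of_ne
    (sumInl_ne_sumInr D p q _ _).symm ((sumInr_injective D p q).ne (hopfOpp_ne q))]

theorem opp_sumInl_of_ne {u : D.Dart} (h₁ : u ≠ p) (h₂ : u ≠ D.opp p) :
    (connectedSum D hopf (.inl p) (.inl q)).opp (sumInl D p q u) = sumInl D p q (D.opp u) := by
  have h₃ : D.opp u ≠ D.opp p := fun h => h₁ (by rw [← D.opp_opp u, h, D.opp_opp])
  rw [connectedSum_opp, Equiv.swap_apply_of_ne_of_ne ((sumInl_injective D p q).ne h₂)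
    (sumInl_ne_sumInr D p q _ _), oppUnion_sumInl, Equiv.swap_apply_of_ne_of_ne
    ((sumInl_injective D p q).ne h₃) (sumInl_ne_sumInr D p q _ _)]

theorem opp_sumInr_self :
    (connectedSum D hopf (.inl p) (.inl q)).opp (sumInr D p q q) = sumInl D p q p := by
  rw [← opp_sumInl_self, opp_opp]

theorem opp_sumInr_opp :
    (connectedSum D hopf (.inl p) (.inl q)).opp (sumInr D p q (hopfOpp q)) =
      sumInl D p q (D.opp p) := by
  rw [← opp_sumInl_opp, opp_opp]

theorem opp_sumInr_of_ne {u : Fin 2 × Fin 4} (h₁ : u ≠ q) (h₂ : u ≠ hopfOpp q) :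
    (connectedSum D hopf (.inl p) (.inl q)).opp (sumInr D p q u) = sumInr D p q (hopfOpp u) := by
  have h₃ : hopfOpp u ≠ q := fun h => h₂ (by rw [← h, hopfOpp_hopfOpp])
  rw [connectedSum_opp, Equiv.swap_apply_of_ne_of_ne (sumInl_ne_sumInr D p q _ _).symm
    ((sumInr_injective D p q).ne h₁), oppUnion_sumInr, Equiv.swap_apply_of_ne_of_ne
    (sumInl_ne_sumInr D p q _ _).symm ((sumInr_injective D p q).ne h₃)]

theorem connectedSumProj_inl (h : Fin 2 → ℤˣ) (u : D.Dart) :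
    connectedSumProj D p q h (.inl (sumInl D p q u)) = some (.inl u) := rfl

theorem connectedSumProj_inr (h : Fin 2 → ℤˣ) (u : Fin 2 × Fin 4) :
    connectedSumProj D p q h (.inl (sumInr D p q u)) = hopfProj (.inl p) q h u := rfl

theorem dart_cases (u : (connectedSum D hopf (.inl p) (.inl q)).Dart) :
    (∃ v, u = sumInl D p q v) ∨ ∃ v, u = sumInr D p q v := by
  obtain ⟨c | i, k⟩ := u
  · exact .inl ⟨(c, k), rfl⟩
  · exact .inr ⟨(i, k), rfl⟩

/-- The places of `D` in a connected sum at arcs. -/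
def connectedSumLift : D.Place → (connectedSum D hopf (.inl p) (.inl q)).Place
  | .inl u => .inl (sumInl D p q u)
  | .inr l => .inr (Fin.cast (Nat.add_zero D.loops).symm l)

variable (s : D.State) (h : Fin 2 → ℤˣ)

/-- The ends `q` and `hopfOpp q` both project to `p`, and `D.opp p` lies on the circle of `p`; this
covers the two new arcs. -/
theorem connectedSumProj_congr_of_joined (u v : (connectedSum D hopf (.inl p) (.inl q)).Place)
    (huv : Joined _ (glueState (Equiv.refl (D.Crossing ⊕ Fin 2)) s h :
      (connectedSum D hopf (.inl p) (.inl q)).State) u v) :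
    (connectedSumProj D p q h u).map (D.circleAt s) =
      (connectedSumProj D p q h v).map (D.circleAt s) := by
  have harc : ∀ u : D.Dart, D.circleAt s (.inl (D.opp u)) = D.circleAt s (.inl u) :=
    fun u => (circleAt_eq_of_joined (Joined.arc u)).symm
  have hq' : hopfProj (.inl p : D.Place) q h (hopfOpp q) = some (.inl p) := by
    rw [hopfProj_hopfOpp, hopfProj_self]
  cases huv with
  | arc w =>
    rcases dart_cases D p q w with ⟨w, rfl⟩ | ⟨w, rfl⟩
    · by_cases h₁ : w = p
      · subst h₁
        rw [opp_sumInl_self, connectedSumProj_inl, connectedSumProj_inr, hopfProj_self]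
      · by_cases h₂ : w = D.opp p
        · subst h₂
          rw [opp_sumInl_opp, connectedSumProj_inl, connectedSumProj_inr, hq']
          exact congrArg some (harc p)
        · rw [opp_sumInl_of_ne D p q h₁ h₂]
          exact congrArg some (harc w).symm
    · by_cases h₁ : w = q
      · subst h₁
        rw [opp_sumInr_self, connectedSumProj_inl, connectedSumProj_inr, hopfProj_self]
      · by_cases h₂ : w = hopfOpp q
        · subst h₂
          rw [opp_sumInr_opp, connectedSumProj_inl, connectedSumProj_inr, hq']
          exact congrArg some (harc p).symm
        · rw [opp_sumInr_of_ne D p q h₁ h₂, connectedSumProj_inr, connectedSumProj_inr,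
            hopfProj_hopfOpp]
  | smooth c k =>
    obtain c | i := c
    · exact congrArg some (circleAt_eq_of_joined (Joined.smooth c k))
    · exact congrArg _ (hopfProj_smoothing (.inl p : D.Place) q h i k).symm

theorem connectedSum_circleAt_of_hopfClass_eq {u v : Fin 2 × Fin 4}
    (huv : hopfClass (h 0) (h 1) u = hopfClass (h 0) (h 1) v) :
    circleAt _ (glueState (Equiv.refl (D.Crossing ⊕ Fin 2)) s h :
      (connectedSum D hopf (.inl p) (.inl q)).State) (.inl (sumInr D p q u)) =
    circleAt _ _ (.inl (sumInr D p q v)) := by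
  refine eq_of_hopfClass_eq (h 0) (h 1) q (fun u => circleAt _ (glueState
    (Equiv.refl (D.Crossing ⊕ Fin 2)) s h : (connectedSum D hopf (.inl p) (.inl q)).State)
    (.inl (sumInr D p q u))) ?_ ?_ huv
  · rintro ⟨i, k⟩
    rw [hopfSmooth_eq]
    exact (circleAt_eq_of_joined (Joined.smooth (D := connectedSum D hopf (.inl p) (.inl q))
      (.inr i) k)).symm
  · intro u h₁ h₂
    rw [← opp_sumInr_of_ne D p q h₁ h₂]
    exact (circleAt_eq_of_joined (Joined.arc _)).symm

theorem connectedSum_circleAt_lift (z z' : D.Place) (hz : D.Joined s z z') :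
    circleAt _ (glueState (Equiv.refl (D.Crossing ⊕ Fin 2)) s h :
      (connectedSum D hopf (.inl p) (.inl q)).State) (connectedSumLift D p q z) =
    circleAt _ _ (connectedSumLift D p q z') := by
  -- The cut arc of `D` is replaced by a detour through the Hopf link, from `q` to `hopfOpp q`,
  -- which lie on one circle even after cutting.
  have hpp : circleAt _ (glueState (Equiv.refl (D.Crossing ⊕ Fin 2)) s h :
      (connectedSum D hopf (.inl p) (.inl q)).State) (.inl (sumInl D p q p)) =
      circleAt _ _ (.inl (sumInl D p q (D.opp p))) := by
    have h₁ := circleAt_eq_of_joined (Joined.arc (s := (glueState (Equiv.refl (D.Crossing ⊕ Fin 2))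
      s h : (connectedSum D hopf (.inl p) (.inl q)).State)) (sumInl D p q p))
    have h₂ := circleAt_eq_of_joined (Joined.arc (s := (glueState (Equiv.refl (D.Crossing ⊕ Fin 2))
      s h : (connectedSum D hopf (.inl p) (.inl q)).State)) (sumInl D p q (D.opp p)))
    rw [opp_sumInl_self] at h₁
    rw [opp_sumInl_opp] at h₂
    rw [h₁, h₂]
    exact connectedSum_circleAt_of_hopfClass_eq D p q s h (hopfClass_hopfOpp _ _ q).symm
  cases hz with
  | arc w =>
    by_cases h₁ : w = p
    · subst h₁
      exact hpp
    · by_cases h₂ : w = D.opp p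
      · subst h₂
        rw [D.opp_opp]
        exact hpp.symm
      · change circleAt _ _ (.inl (sumInl D p q w)) = circleAt _ _ (.inl (sumInl D p q (D.opp w)))
        rw [← opp_sumInl_of_ne D p q h₁ h₂]
        exact circleAt_eq_of_joined (Joined.arc _)
  | smooth c k =>
    exact circleAt_eq_of_joined (Joined.smooth (D := connectedSum D hopf (.inl p) (.inl q))
      (.inl c) k)

/-- The connected sum of `D` and the Hopf link diagram at arcs. -/
def connectedSumExtension : HopfExtension D (connectedSum D hopf (.inl p) (.inl q)) where
  crossing := Equiv.refl _
  base := .inl p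
  proj := connectedSumProj D p q
  lift := connectedSumLift D p q
  proj_crossing _ _ _ := rfl
  proj_lift h z := by
    rcases z with u | l <;> rfl
  proj_cases v := by
    obtain u | l := v
    · rcases dart_cases D p q u with ⟨w, rfl⟩ | ⟨w, rfl⟩
      · exact .inl ⟨.inl w, fun _ => rfl⟩
      · exact .inr fun h => hopfProj_cases (.inl p : D.Place) q h w
    · exact .inl ⟨_, fun _ => rfl⟩
  proj_hopf h i k := (hopfProj_cases (.inl p : D.Place) q h (i, k)).imp_right And.right
  touch_base h i := exists_hopfProj_eq_some (.inl p : D.Place) q h i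
  touch_none h i hh := exists_hopfProj_eq_none (.inl p : D.Place) q h i hh
  map_eq_of_joined := connectedSumProj_congr_of_joined D p q
  circleAt_lift := connectedSum_circleAt_lift D p q
  circleAt_of_some s h v z hv := by
    obtain u | l := v
    · rcases dart_cases D p q u with ⟨w, rfl⟩ | ⟨w, rfl⟩
      · cases hv
        rfl
      · obtain ⟨hw, rfl⟩ := hopfClass_eq_of_hopfProj_eq_some (.inl p : D.Place) q h hv
        refine (connectedSum_circleAt_of_hopfClass_eq D p q s h hw).trans ?_
        refine (circleAt_eq_of_joined (Joined.arc (sumInr D p q q))).trans ?_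
        rw [opp_sumInr_self]
        rfl
    · cases hv
      rfl
  circleAt_of_none s h u v hu hv := by
    obtain u | l := u
    · obtain v | l := v
      · rcases dart_cases D p q u with ⟨u, rfl⟩ | ⟨u, rfl⟩
        · cases hu
        · rcases dart_cases D p q v with ⟨v, rfl⟩ | ⟨v, rfl⟩
          · cases hv
          · exact connectedSum_circleAt_of_hopfClass_eq D p q s h
              (hopfClass_eq_of_hopfProj_eq_none (.inl p : D.Place) q h hu hv)
      · cases hv
    · cases hu

end connectedSum

/-- Summing along a crossingless curve is therefore possible only at the first step, starting from
the trivial knot. -/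
theorem IsHopfSum.eq_trivialKnot_or {n : ℕ} {D : LinkDiagram} (hD : D.IsHopfSum n) :
    (n = 0 ∧ D = trivialKnot) ∨ D.loops = 0 := by
  induction hD with
  | zero => exact .inl ⟨rfl, rfl⟩
  | one => exact .inr rfl
  | succ n D x y _ ih =>
    refine .inr ?_
    obtain q | l := y
    · rcases ih with ⟨-, rfl⟩ | ih
      · obtain ⟨c, k⟩ | l := x
        · exact Empty.elim c
        · rfl
      · obtain p | l := x
        · exact ih
        · exact (Fin.cast ih l).elim0
    · exact l.elim0

/-! ### The trivial knot -/

/-- The enhanced state of the trivial knot with a given sign. -/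
def trivialKnotState (a : ℤˣ) : trivialKnot.EnhancedState := ⟨isEmptyElim, fun _ => a⟩

theorem trivialKnotState_surjective (S : trivialKnot.EnhancedState) :
    ∃ a, S = trivialKnotState a := by
  refine ⟨S.val (.inr (0 : Fin 1)), ext_val (Subsingleton.elim _ _) fun x => ?_⟩
  rw [trivialKnot_place_eq x]
  rfl

theorem trivialKnotState_sigma (a : ℤˣ) : (trivialKnotState a).sigma = 0 :=
  Finset.sum_of_isEmpty _

theorem trivialKnotState_tau (a : ℤˣ) : (trivialKnotState a).tau = a := by
  let x : trivialKnot.Place := .inr (0 : Fin 1)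
  have hγ : ∀ γ, γ = trivialKnot.circleAt (trivialKnotState a).marker x := by
    intro γ
    obtain ⟨y, rfl⟩ := circle_surjective γ
    rw [trivialKnot_place_eq y]
  exact Fintype.sum_eq_single _ fun γ hne => (hne (hγ γ)).elim

theorem card_gradedState_trivialKnot (i j : ℤ) :
    Fintype.card (trivialKnot.GradedState i j) = hopfRank 0 i j := by
  have key : ∀ S : trivialKnot.GradedState i j, ∃ a : ℤˣ, S.1 = trivialKnotState a ∧
      i = 0 ∧ j = 2 * a := by
    intro S
    obtain ⟨a, ha⟩ := trivialKnotState_surjective S.1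
    have := S.2
    rw [ha, trivialKnotState_sigma, trivialKnotState_tau] at this
    exact ⟨a, ha, this.1.symm, by linarith [this.2]⟩
  by_cases h : ∃ a : ℤˣ, i = 0 ∧ j = 2 * a
  · obtain ⟨a, rfl, rfl⟩ := h
    have h₁ : hopfRank 0 0 (2 * a) = 1 := by
      rcases Int.units_eq_one_or a with rfl | rfl <;> rfl
    rw [h₁, Fintype.card_eq_one_iff]
    refine ⟨⟨trivialKnotState a, trivialKnotState_sigma a, ?_⟩, fun S => Subtype.ext ?_⟩
    · rw [trivialKnotState_sigma, trivialKnotState_tau, zero_add]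
    · obtain ⟨b, hb, -, hab⟩ := key S
      have : a = b := Units.ext (by linarith)
      rw [hb, this]
  · have : IsEmpty (trivialKnot.GradedState i j) :=
      ⟨fun S => let ⟨a, _, ha⟩ := key S; h ⟨a, ha⟩⟩
    rw [Fintype.card_eq_zero]
    refine (if_neg ?_).symm
    rintro ⟨hi, hj | hj⟩
    · exact h ⟨1, hi, by simpa using hj⟩
    · exact h ⟨-1, hi, by simpa using hj⟩

/-- Without crossings d = 0, so homology is the chain group; the empty relation is a tournament on
the empty set. -/
theorem hasHopfHomology_trivialKnot :
    HasHopfHomology 0 trivialKnot fun _ _ => False := by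
  have hd : diff (D := trivialKnot) (fun _ _ => False) = 0 := by
    ext z S
    simp [diff_apply, relCoefficient]
  have hequiv : ∀ i j, Nonempty (HomologyAt (diff (D := trivialKnot) fun _ _ => False)
      (trivialKnot.gradedPart i j) (trivialKnot.gradedPart (i + 2) j) ≃ₗ[ℤ]
      trivialKnot.Chain i j) := by
    intro i j
    let e : trivialKnot.CrossingOrder := Fintype.equivFin _
    rw [hd]
    have h₁ := LinearEquiv.ofInjective (chainInclusion e (fun _ _ => False) i j)
      (chainInclusion_injective e _ i j)
    rw [range_chainInclusion] at h₁
    exact ⟨((Submodule.quotEquivOfEqBot _ (by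
      rw [Submodule.map_zero, Submodule.comap_bot, Submodule.ker_subtype])).trans
      (LinearEquiv.ofEq _ _ (by rw [LinearMap.ker_zero, top_inf_eq]))).trans h₁.symm⟩
  refine ⟨⟨isEmptyElim, isEmptyElim⟩, ?_, ?_, ?_, ?_, ?_⟩
  · simp [hd]
  · simp [hd]
  · intro i j
    obtain ⟨e⟩ := hequiv i j
    exact Module.Free.of_equiv e.symm
  · intro i j
    obtain ⟨e⟩ := hequiv i j
    exact Module.Finite.equiv e.symm
  · intro i j
    obtain ⟨e⟩ := hequiv i j
    rw [e.finrank_eq, Module.finrank_finsupp_self, card_gradedState_trivialKnot]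

/-! ### Connected sums of Hopf links -/

theorem IsHopfSum.exists_hasHopfHomology {n : ℕ} {D : LinkDiagram} (hD : D.IsHopfSum n) :
    ∃ r, HasHopfHomology n D r := by
  induction hD with
  | zero => exact ⟨_, hasHopfHomology_trivialKnot⟩
  | one => exact ⟨_, hasHopfHomology_trivialKnot.extend hopfExtensionHopf⟩
  | succ n D x y hD ih =>
    obtain ⟨r, hr⟩ := ih
    obtain q | l := y
    · obtain p | l := x
      · exact ⟨_, hr.extend (connectedSumExtension D p q)⟩
      · rcases hD.eq_trivialKnot_or with ⟨rfl, rfl⟩ | h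
        · exact ⟨_, hasHopfHomology_trivialKnot.extend (hopfExtensionTrivialKnot l q)⟩
        · exact (Fin.cast h l).elim0
    · exact l.elim0

/-! ### Coefficients of the polynomial -/

theorem coeff_mul_monomial (P : Laurent₂) (i j k l : ℤ) :
    (P * monomial i j).coeff (k, l) = P.coeff (k - i, l - j) := by
  rw [monomial, AddMonoidAlgebra.coeff_mul_single_eq_coeff_mul (k - i, l - j), mul_one]
  rintro ⟨a, b⟩ -
  simp only [Prod.mk_add_mk, Prod.mk.injEq]
  omega

/-- The recursion of `hopfRank` is multiplication by the Hopf factor read on coefficients. -/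
theorem coeff_hopfPolynomial (n : ℕ) (i j : ℤ) :
    ((monomial 0 2 + monomial 0 (-2)) * (monomial 2 4 + monomial (-2) (-4)) ^ n :
      Laurent₂).coeff (i, j) = hopfRank n i j := by
  induction n generalizing i j with
  | zero =>
    rw [pow_zero, mul_one, AddMonoidAlgebra.coeff_add, Finsupp.add_apply, monomial, monomial,
      AddMonoidAlgebra.coeff_single, AddMonoidAlgebra.coeff_single, Finsupp.single_apply,
      Finsupp.single_apply]
    simp only [hopfRank, Prod.mk.injEq]
    split_ifs <;> first | rfl | omega
  | succ n ih =>
    rw [pow_succ, ← mul_assoc, mul_add, AddMonoidAlgebra.coeff_add, Finsupp.add_apply,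
      coeff_mul_monomial, coeff_mul_monomial, ih, ih, hopfRank]
    push_cast
    simp only [sub_neg_eq_add]

end LinkDiagram

open LinkDiagram in
/-- The first conjunct says that the maps `d_{i,j}` do form a chain complex. -/
theorem corollary6p6 (n : ℕ) (D : LinkDiagram) (hD : D.IsHopfSum n) (e : D.CrossingOrder) :
    (∀ i j : ℤ, D.boundary e i (i - 2) j ∘ₗ D.boundary e (i + 2) i j = 0) ∧
    (∀ i j : ℤ, Module.Free ℤ (D.Homology e i j) ∧ Module.Finite ℤ (D.Homology e i j)) ∧
    D.generatingPolynomial e =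
      (monomial 0 2 + monomial 0 (-2)) * (monomial 2 4 + monomial (-2) (-4)) ^ n := by
  obtain ⟨r, hr⟩ := hD.exists_hasHopfHomology
  refine ⟨boundary_comp_boundary e hr.isTournament hr.diff_diff, fun i j => ?_, ?_⟩
  · obtain ⟨f⟩ := nonempty_homology_equiv e hr.isTournament i j
    have := hr.free i j
    have := hr.finite i j
    exact ⟨Module.Free.of_equiv f.symm, Module.Finite.equiv f.symm⟩
  · ext ⟨i, j⟩
    obtain ⟨f⟩ := nonempty_homology_equiv e hr.isTournament i j
    rw [coeff_hopfPolynomial, ← hr.finrank, ← f.finrank_eq]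
    rfl
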